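/- Fix orders $p_a,p_b,p_f,p_c,p_d\ge 0$. A parameter is $\theta=(\theta_A,\theta_B,\theta_F,\theta_C,\theta_D)\in\mathbb R^{p_\theta}$, $p_\theta=p_a+p_b+p_f+p_c+p_d$, with coordinates $a_j,b_j,f_j,c_j,d_j$, and $A(q)=1+\sum_{j=1}^{p_a}a_jq^{-j}$, $B(q)=\sum_{j=1}^{p_b}b_jq^{-j}$, $F(q)=1+\sum_{j=1}^{p_f}f_jq^{-j}$, $C(q)=1+\sum_{j=1}^{p_c}c_jq^{-j}$, $D(q)=1+\sum_{j=1}^{p_d}d_jq^{-j}$, where $q^{-1}$ is the backward shift; polynomials of the true parameter $\theta^*$ carry a star. *Parameter domain.* $D_\theta=\{\theta: g(\theta)\le K,\ \theta_C\in D_C,\ \theta_F\in D_F\}$ is compact, where $K>0$, $g:\mathbb R^{p_\theta}\to[0,\infty)$ is continuous, and $D_C$, $D_F$ are compact convex sets such that, for some $\lambda_c,\lambda_f\in(0,1)$ and symmetric positive definite $V_c,V_f$, $\tilde C(\theta_C)^TV_c\tilde C(\theta_C)\le\lambda_cV_c$ for all $\theta_C\in D_C$ and $\tilde F(\theta_F)^TV_f\tilde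 F(\theta_F)\le\lambda_fV_f$ for all $\theta_F\in D_F$; here $\tilde C(\theta_C)$, $\tilde F(\theta_F)$ are the companion matrices with first row $-c_1,\dots,-c_{p_c}$ (resp. $-f_1,\dots,-f_{p_f}$) and ones on the subdiagonal. Moreover $\theta^*\in\operatorname{int}D_\theta$. *True system.* $A^*(q)y_n=\frac{B^*(q)}{F^*(q)}u_n+\frac{C^*(q)}{D^*(q)}e_n$, $n\ge0$, with all signals zero for $n<0$; $A^*(z),F^*(z),C^*(z),D^*(z)\ne0$ for all complex $|z|\ge1$; and: (i) $z^{p_a}A^*(z),z^{p_b}B^*(z),z^{p_c}C^*(z)$ have no factor common to all three; (ii) $z^{p_b}B^*,z^{p_f}F^*$ have no common factor; (iii) neither do $z^{p_c}C^*,z^{p_d}D^*$; (iv) if $p_a\ge1$, neither do $z^{p_f}F^*,z^{p_d}D^*$; (v) if $p_d\ge1$, neither do $z^{p_a}A^*,z^{p_b}B^*$; (vi) if $p_f\ge1$, neither do $z^{p_a}A^*,z^{p_c}C^*$. *Noise.* $(e_n)_{n\ge0}$ and $(s_n)_{n\ge0}$ are sequences of independent random variables, independent of each other, of mean zero, with $E[e_n^2]=\sigma^2>0$,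 $E[s_n^2]=1$, and $\sup_nE[\exp(\alpha_ee_n^2)]<\infty$, $\sup_nE[\exp(\alpha_ss_n^2)]<\infty$ for some $\alpha_e,\alpha_s>0$. *Input.* For a fixed value $r$ of the design variable, $u_n=u_n(r)$ is given by $z_0=0$, $z_{n+1}=A_z(r)z_n+B_z(r)s_n$, $u_n=C_z(r)z_n+D_z(r)s_n$ with $z_n\in\mathbb R^m$. The function $\theta\mapsto r(\theta)$ is continuous on $D_\theta$, and $A_z,B_z,C_z,D_z$ are continuous functions of $r$. The set $\{A_z(r(\theta)):\theta\in D_\theta\}$ has joint spectral radius $\limsup_n\sup\{\rho(M)^{1/n}: M \text{ a product of } n \text{ elements of the set}\}$ less than one. The input at $\theta^*$ is persistently exciting: with $G_s(z)=C_z[zI-A_z]^{-1}B_z+D_z$ evaluated at $r(\theta^*)$, $|G_s(e^{i\omega})|^2>0$ for almost all $\omega$. *Prediction error.* Let $y_n(r)$ be the output of the true system for the input $u_n(r)$, and $$\bar\varepsilon_n(\theta,r)=y_n(r)-\hat y_n(\theta,r),\qquad \hat y_n(\theta,r)=\frac{D(q)B(q)}{C(q)F(q)}u_n(r)+\Big[1-\frac{D(q)A(q)}{C(q)}\Big]y_n(r).$$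 Let $\bar\varepsilon_{\theta,n}(\theta,r)=\frac{\partial}{\partial\theta}\bar\varepsilon_n(\theta,r)$ be the gradient in $\theta$ with $r$ held fixed, and $\bar\varepsilon_{\theta,n}(\theta)=\bar\varepsilon_{\theta,n}(\theta,r(\theta))$. *Claim.* For every $\theta\in D_\theta$ the limit $G(\theta)=\lim_{n\to\infty}E[\bar\varepsilon_{\theta,n}(\theta)\bar\varepsilon_{\theta,n}(\theta)^T]$ exists (the gradients exist and the expectations are finite), and there is a set $D_{\theta^*}\subseteq D_\theta$ with $\theta^*\in\operatorname{int}D_{\theta^*}$ such that $G(\theta)$ is symmetric positive definite for all $\theta\in D_{\theta^*}$. -/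

import Mathlib

open MeasureTheory ProbabilityTheory Filter Topology

noncomputable section

namespace LTI

/-- The orders `p_a, p_b, p_f, p_c, p_d` of the model structure. -/
structure Orders where
  a : ℕ
  b : ℕ
  f : ℕ
  c : ℕ
  d : ℕ

/-- Coordinates of a parameter vector, in the block order `A, B, F, C, D`. -/
abbrev Idx (p : Orders) : Type := Fin p.a ⊕ Fin p.b ⊕ Fin p.f ⊕ Fin p.c ⊕ Fin p.d

/-- Parameter vectors `θ = (θ_A, θ_B, θ_F, θ_C, θ_D)`. -/
abbrev Param (p : Orders) : Type := Idx p → ℝ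

variable {p : Orders}

def parA (θ : Param p) : Fin p.a → ℝ := fun j => θ (.inl j)
def parB (θ : Param p) : Fin p.b → ℝ := fun j => θ (.inr (.inl j))
def parF (θ : Param p) : Fin p.f → ℝ := fun j => θ (.inr (.inr (.inl j)))
def parC (θ : Param p) : Fin p.c → ℝ := fun j => θ (.inr (.inr (.inr (.inl j))))
def parD (θ : Param p) : Fin p.d → ℝ := fun j => θ (.inr (.inr (.inr (.inr j))))

/-- `∑_{j=1}^{k} x_j X^j`; the indeterminate `X` stands for the backward shift `q⁻¹`. -/
def shiftSum {k : ℕ} (x : Fin k → ℝ) : Polynomial ℝ :=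
  ∑ j : Fin k, Polynomial.C (x j) * Polynomial.X ^ ((j : ℕ) + 1)

def polyA (θ : Param p) : Polynomial ℝ := 1 + shiftSum (parA θ)
def polyB (θ : Param p) : Polynomial ℝ := shiftSum (parB θ)
def polyF (θ : Param p) : Polynomial ℝ := 1 + shiftSum (parF θ)
def polyC (θ : Param p) : Polynomial ℝ := 1 + shiftSum (parC θ)
def polyD (θ : Param p) : Polynomial ℝ := 1 + shiftSum (parD θ)

/-- `P(z) ≠ 0` for all complex `|z| ≥ 1`, where `P` is a polynomial in `z⁻¹`. -/
def NoZeroOutside (P : Polynomial ℝ) : Prop :=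
  ∀ z : ℂ, 1 ≤ ‖z‖ → Polynomial.aeval z⁻¹ P ≠ 0

/-- `A, F, C, D` have no zeros in `|z| ≥ 1`. -/
def StableParam (θ : Param p) : Prop :=
  NoZeroOutside (polyA θ) ∧ NoZeroOutside (polyF θ) ∧
    NoZeroOutside (polyC θ) ∧ NoZeroOutside (polyD θ)

/-- The coprimeness conditions i) - vi). `Polynomial.reflect k P` is the polynomial `z^k P(z)` in
`z`, for `P` a polynomial in `z⁻¹` of degree at most `k`. -/
def Identifiable (θ : Param p) : Prop :=
  let zA := Polynomial.reflect p.a (polyA θ)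
  let zB := Polynomial.reflect p.b (polyB θ)
  let zF := Polynomial.reflect p.f (polyF θ)
  let zC := Polynomial.reflect p.c (polyC θ)
  let zD := Polynomial.reflect p.d (polyD θ)
  (∀ h : Polynomial ℝ, h ∣ zA → h ∣ zB → h ∣ zC → IsUnit h) ∧
  IsRelPrime zB zF ∧
  IsRelPrime zC zD ∧
  (1 ≤ p.a → IsRelPrime zF zD) ∧
  (1 ≤ p.d → IsRelPrime zA zB) ∧
  (1 ≤ p.f → IsRelPrime zA zC)

/-- The companion matrix of `1 + ∑ c_j q^{-j}`: first row `-c_1, …, -c_k`, ones on the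
subdiagonal. -/
def companion {k : ℕ} (c : Fin k → ℝ) : Matrix (Fin k) (Fin k) ℝ :=
  Matrix.of fun i j => if (i : ℕ) = 0 then -c j else if (i : ℕ) = (j : ℕ) + 1 then 1 else 0

/-- A common quadratic Lyapunov function, with a common contraction rate, for the companion
matrices of all parameters in `S`. -/
def HasCommonLyapunov {k : ℕ} (S : Set (Fin k → ℝ)) : Prop :=
  ∃ lam : ℝ, 0 < lam ∧ lam < 1 ∧ ∃ V : Matrix (Fin k) (Fin k) ℝ, V.PosDef ∧
    ∀ c ∈ S, (lam • V - (companion c).transpose * V * companion c).PosSemidef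

/-- The parameter domain `{θ : g θ ≤ K, θ_C ∈ D_C, θ_F ∈ D_F}`. -/
def paramDomain (g : Param p → ℝ) (K : ℝ) (DC : Set (Fin p.c → ℝ)) (DF : Set (Fin p.f → ℝ)) :
    Set (Param p) :=
  {θ | g θ ≤ K ∧ parC θ ∈ DC ∧ parF θ ∈ DF}

/-- An input generator: state-space matrices depending on a design variable in `R`. -/
structure InputGenerator (R : Type*) (m : ℕ) where
  Az : R → Matrix (Fin m) (Fin m) ℝ
  Bz : R → Fin m → ℝ
  Cz : R → Fin m → ℝ
  Dz : R → ℝ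

variable {R : Type*} {m : ℕ}

/-- State of the generator with frozen design variable `r`, driven by `s`, at rest before
time `0`. -/
def genState (gen : InputGenerator R m) (r : R) (s : ℕ → ℝ) : ℕ → Fin m → ℝ
  | 0 => 0
  | n + 1 => (gen.Az r).mulVec (genState gen r s n) + s n • gen.Bz r

/-- The input `u_n(r)` produced by the generator with frozen design variable `r`. -/
def input (gen : InputGenerator R m) (r : R) (s : ℕ → ℝ) (n : ℕ) : ℝ :=
  dotProduct (gen.Cz r) (genState gen r s n) + gen.Dz r * s n

/-- The transfer function `G_s(z) = C_z (z I - A_z)⁻¹ B_z + D_z`. -/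
def genTransfer (gen : InputGenerator R m) (r : R) (z : ℂ) : ℂ :=
  dotProduct (fun i => (gen.Cz r i : ℂ))
    ((z • (1 : Matrix (Fin m) (Fin m) ℂ) - (gen.Az r).map Complex.ofReal)⁻¹.mulVec
      (fun i => (gen.Bz r i : ℂ))) + (gen.Dz r : ℂ)

/-- The spectrum of the input, at the frequency `w`, for unit-variance white driving noise. -/
def inputSpectrum (gen : InputGenerator R m) (r : R) (w : ℝ) : ℝ :=
  ‖genTransfer gen r (Complex.exp (Complex.I * w))‖ ^ 2

/-- The joint spectral radius `limsup_n sup {ρ(M)^{1/n} : M a product of n elements of S}`. -/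
def jointSpectralRadius (S : Set (Matrix (Fin m) (Fin m) ℝ)) : ENNReal :=
  limsup (fun n : ℕ =>
    ⨆ L : {L : List (Matrix (Fin m) (Fin m) ℝ) // L.length = n ∧ ∀ M ∈ L, M ∈ S},
      spectralRadius ℂ ((L.1.prod).map Complex.ofReal) ^ (1 / (n : ℝ))) atTop

/-- A polynomial in `q⁻¹` as a causal filter. A signal `x_0, x_1, …` that vanishes before time `0`
is identified with the power series `∑ x_n X^n`; applying a causal filter is multiplication of
power series. -/
def filt (P : Polynomial ℝ) : PowerSeries ℝ := (P : PowerSeries ℝ)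

/-- The output `y` of the system `A y = (B/F) u + (C/D) e` with parameter `θ`, at rest before
time `0`. -/
def output (θ : Param p) (u e : ℕ → ℝ) (n : ℕ) : ℝ :=
  PowerSeries.coeff n
    ((filt (polyA θ))⁻¹ *
      (filt (polyB θ) * (filt (polyF θ))⁻¹ * PowerSeries.mk u +
        filt (polyC θ) * (filt (polyD θ))⁻¹ * PowerSeries.mk e))

/-- The one-step predictor `ŷ(θ) = (D B)/(C F) u + (1 - (D A)/C) y`. -/
def predictor (θ : Param p) (u y : ℕ → ℝ) (n : ℕ) : ℝ :=
  PowerSeries.coeff n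
    (filt (polyD θ) * filt (polyB θ) * (filt (polyC θ) * filt (polyF θ))⁻¹ * PowerSeries.mk u +
      (1 - filt (polyD θ) * filt (polyA θ) * (filt (polyC θ))⁻¹) * PowerSeries.mk y)

/-- The prediction error `y_n - ŷ_n(θ)`. -/
def predError (θ : Param p) (u y : ℕ → ℝ) (n : ℕ) : ℝ := y n - predictor θ u y n

/-- The gradient of the prediction error with respect to `θ`, the data `u, y` being held fixed. -/
def predErrorGrad (θ : Param p) (u y : ℕ → ℝ) (n : ℕ) (i : Idx p) : ℝ :=
  fderiv ℝ (fun θ' : Param p => predError θ' u y n) θ (Pi.single i 1)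

variable {Ω : Type*} [MeasurableSpace Ω]

/-- The input process `u_n(r)`. -/
def inputProc (gen : InputGenerator R m) (r : R) (s : ℕ → Ω → ℝ) (ω : Ω) : ℕ → ℝ :=
  input gen r (fun n => s n ω)

/-- The output process `y_n(r)` of the true system `θs` under the input `u_n(r)`. -/
def outputProc (θs : Param p) (gen : InputGenerator R m) (r : R) (e s : ℕ → Ω → ℝ) (ω : Ω) :
    ℕ → ℝ :=
  output θs (inputProc gen r s ω) (fun n => e n ω)

/-- The prediction error process at the parameter `θ` under the frozen design variable `r`. -/
def errProc (θs : Param p) (gen : InputGenerator R m) (r : R) (e s : ℕ → Ω → ℝ)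
    (θ : Param p) (n : ℕ) (ω : Ω) : ℝ :=
  predError θ (inputProc gen r s ω) (outputProc θs gen r e s ω) n

/-- Its gradient with respect to `θ`, with `r` held fixed. -/
def errGradProc (θs : Param p) (gen : InputGenerator R m) (r : R) (e s : ℕ → Ω → ℝ)
    (θ : Param p) (n : ℕ) (ω : Ω) : Idx p → ℝ :=
  predErrorGrad θ (inputProc gen r s ω) (outputProc θs gen r e s ω) n

/-- The matrix of second moments of the gradient at time `n`. -/
def gradSecondMoment (P : Measure Ω) (θs : Param p) (gen : InputGenerator R m) (r : R)
    (e s : ℕ → Ω → ℝ) (θ : Param p) (n : ℕ) : Matrix (Idx p) (Idx p) ℝ :=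
  Matrix.of fun i j =>
    ∫ ω, errGradProc θs gen r e s θ n ω i * errGradProc θs gen r e s θ n ω j ∂P

/-- A sequence of independent random variables with mean `0`, second moment `v` and
`sup_n E exp(α x_n²) < ∞` for some `α > 0`. -/
def IsNoise (P : Measure Ω) (x : ℕ → Ω → ℝ) (v : ℝ) : Prop :=
  (∀ n, Measurable (x n)) ∧ iIndepFun x P ∧
  (∀ n, ∫ ω, x n ω ∂P = 0) ∧ (∀ n, ∫ ω, x n ω ^ 2 ∂P = v) ∧
  ∃ α : ℝ, 0 < α ∧ ∃ M : ℝ, ∀ n, Integrable (fun ω => Real.exp (α * x n ω ^ 2)) P ∧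
    ∫ ω, Real.exp (α * x n ω ^ 2) ∂P ≤ M

end LTI

end

/-! Signals at rest before time 0 are power series and causal filters act by multiplication. The
derivative of the prediction error in a direction `v` is therefore `S_v * s + E_v * e`, where `S_v`
(`gradS`) and `E_v` (`gradE`) are linear in `v`. Since the noises are uncorrelated, the second
moment matrix at time `n` is the sum over lags `0, …, n` of a fixed series of rank-limited Gram
terms. It converges as soon as the filters are absolutely summable. Summability comes from the
Lyapunov condition for `C` and `F` (`noZeroOutside_of_lyapunov`), from the stability of the true
system, and from the spectral radius bound for the generator.

Positivity at the true parameter is algebra. A null direction `v` of the limit has `S_v = 0` and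
`E_v = 0` as power series. The generator has a nonzero impulse response `g`, because its transfer
function is nonzero at some frequency, so `g` cancels in the domain of power series. Clearing
denominators leaves two polynomial tangent equations, and the coprimeness conditions together with
degree bounds force `v = 0` (`tangent_eq_zero`).

To pass to a neighbourhood, no continuity of the limit in `θ` is needed, hence no uniform bound on
tails. The quadratic forms of the partial Gram matrices increase with the number of lags. At the
true parameter some partial Gram matrix is already nonsingular. Its determinant involves finitely
many coefficients, each continuous in `θ`, so it stays nonzero nearby, and the full Gram matrix
dominates it (`posDef_gram_of_det_partialGram_ne_zero`). -/

noncomputable section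

namespace LTI

/-! ### Stable filters and inverses of polynomials -/

/-- Power series with absolutely summable coefficients: the stable impulse responses. -/
def AbsSummable {𝕜 : Type*} [NormedField 𝕜] (f : PowerSeries 𝕜) : Prop :=
  Summable fun n => ‖PowerSeries.coeff n f‖

namespace AbsSummable

variable {𝕜 : Type*} [NormedField 𝕜] {f g : PowerSeries 𝕜}

theorem add (hf : AbsSummable f) (hg : AbsSummable g) : AbsSummable (f + g) := by
  refine (Summable.add hf hg).of_nonneg_of_le (fun _ => norm_nonneg _) fun n => ?_
  rw [map_add]
  exact norm_add_le _ _

theorem neg (hf : AbsSummable f) : AbsSummable (-f) := by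
  simpa [AbsSummable] using hf

theorem sub (hf : AbsSummable f) (hg : AbsSummable g) : AbsSummable (f - g) :=
  sub_eq_add_neg f g ▸ hf.add hg.neg

theorem mul (hf : AbsSummable f) (hg : AbsSummable g) : AbsSummable (f * g) := by
  simpa only [AbsSummable, PowerSeries.coeff_mul] using
    summable_norm_sum_mul_antidiagonal_of_summable_norm hf hg

theorem coe (P : Polynomial 𝕜) : AbsSummable (P : PowerSeries 𝕜) := by
  refine summable_of_ne_finset_zero (s := P.support) fun n hn => ?_
  simpa using hn

theorem one : AbsSummable (1 : PowerSeries 𝕜) := by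
  simpa using coe (1 : Polynomial 𝕜)

/-- The inverse of a linear factor with root outside the closed unit disc. -/
theorem inv_X_sub_C {r : 𝕜} (hr : 1 < ‖r‖) :
    AbsSummable ((Polynomial.X - Polynomial.C r : Polynomial 𝕜) : PowerSeries 𝕜)⁻¹ := by
  have hr0 : r ≠ 0 := by rintro rfl; simp at hr; linarith
  have h : ((Polynomial.X - Polynomial.C r : Polynomial 𝕜) : PowerSeries 𝕜)⁻¹ =
      PowerSeries.mk fun n => -r⁻¹ ^ (n + 1) := by
    rw [eq_comm, PowerSeries.eq_inv_iff_mul_eq_one (by simpa using hr0)]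
    ext n
    rw [Polynomial.coe_sub, Polynomial.coe_X, Polynomial.coe_C, mul_sub, map_sub,
      PowerSeries.coeff_mul_C, PowerSeries.coeff_mk]
    cases n with
    | zero => simp [hr0]
    | succ n =>
      rw [PowerSeries.coeff_succ_mul_X, PowerSeries.coeff_mk, PowerSeries.coeff_one]
      simp only [Nat.add_eq_zero_iff, one_ne_zero, and_false, if_false]
      linear_combination r⁻¹ ^ (n + 1) * mul_inv_cancel₀ hr0
  rw [h]
  have h1 : ‖r⁻¹‖ < 1 := by rw [norm_inv]; exact inv_lt_one_of_one_lt₀ hr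
  have := (summable_geometric_of_lt_one (norm_nonneg _) h1).mul_left ‖r⁻¹‖
  refine this.congr fun n => ?_
  rw [PowerSeries.coeff_mk, norm_neg, norm_pow, pow_succ']

/-- Absolute summability is multiplicative, so the linear factors can be inverted one at a time. -/
theorem inv_coe_of_splits {P : Polynomial 𝕜} (hP : P.Splits) (hP0 : P ≠ 0)
    (h : ∀ z, ‖z‖ ≤ 1 → P.eval z ≠ 0) : AbsSummable (P : PowerSeries 𝕜)⁻¹ := by
  have key : ∀ s : Multiset 𝕜, (∀ r ∈ s, 1 < ‖r‖) →
      AbsSummable (((s.map fun x => Polynomial.X - Polynomial.C x).prod :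
        Polynomial 𝕜) : PowerSeries 𝕜)⁻¹ := by
    intro s
    induction s using Multiset.induction with
    | empty => intro _; simpa using one
    | cons a s ih =>
      intro hs
      rw [Multiset.map_cons, Multiset.prod_cons, Polynomial.coe_mul, PowerSeries.mul_inv_rev]
      exact (ih fun r hr => hs r (Multiset.mem_cons_of_mem hr)).mul
        (inv_X_sub_C (hs a (Multiset.mem_cons_self a s)))
  rw [hP.eq_prod_roots, Polynomial.coe_mul, PowerSeries.mul_inv_rev]
  refine (key _ fun r hr => ?_).mul ?_
  · by_contra hle
    exact h r (not_lt.1 hle) ((Polynomial.mem_roots hP0).1 hr)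
  · rw [Polynomial.coe_C, PowerSeries.C_inv, ← Polynomial.coe_C]
    exact coe _

end AbsSummable

/-- Over `ℂ` the polynomial splits. The substitution `X = z⁻¹` carries `|z| ≥ 1` to the punctured
closed unit disc, and the normalisation of the constant coefficient covers the remaining point `X =
0`. Base change to `ℂ` preserves the norms of the coefficients. -/
theorem absSummable_inv_coe {P : Polynomial ℝ} (h0 : P.coeff 0 = 1) (hP : NoZeroOutside P) :
    AbsSummable (P : PowerSeries ℝ)⁻¹ := by
  set Q : Polynomial ℂ := P.map Complex.ofRealHom with hQ
  have hQ0 : Q.coeff 0 = 1 := by simp [hQ, h0]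
  have hQne : Q ≠ 0 := by rintro h; simp [h] at hQ0
  have hs : AbsSummable (Q : PowerSeries ℂ)⁻¹ := by
    refine AbsSummable.inv_coe_of_splits (IsAlgClosed.splits Q) hQne fun z hz => ?_
    by_cases hz0 : z = 0
    · rw [hz0, ← Polynomial.coeff_zero_eq_eval_zero, hQ0]; exact one_ne_zero
    · have := hP z⁻¹ (by rw [norm_inv]; exact (one_le_inv₀ (norm_pos_iff.2 hz0)).2 hz)
      rwa [inv_inv, Polynomial.aeval_def, ← Polynomial.eval_map] at this
  have hmap : PowerSeries.map Complex.ofRealHom (P : PowerSeries ℝ)⁻¹ = (Q : PowerSeries ℂ)⁻¹ := by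
    rw [PowerSeries.eq_inv_iff_mul_eq_one (by simp [hQ0]), hQ,
      Polynomial.polynomial_map_coe, ← map_mul, PowerSeries.inv_mul_cancel _ (by simp [h0]), map_one]
  refine hs.congr fun n => ?_
  rw [← hmap, PowerSeries.coeff_map]
  simp

/-! ### Companion matrices -/

theorem coeff_zero_shiftSum {k : ℕ} (x : Fin k → ℝ) : (shiftSum x).coeff 0 = 0 := by
  simp [shiftSum]

theorem coeff_shiftSum {k : ℕ} (x : Fin k → ℝ) (j : Fin k) :
    (shiftSum x).coeff (j + 1) = x j := by
  simp only [shiftSum, Polynomial.finsetSum_coeff, Polynomial.coeff_C_mul_X_pow]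
  rw [Finset.sum_eq_single j]
  · simp
  · intro i _ hi
    rw [if_neg]
    intro h
    exact hi (Fin.ext (by omega))
  · simp

theorem natDegree_shiftSum_le {k : ℕ} (x : Fin k → ℝ) : (shiftSum x).natDegree ≤ k := by
  refine Polynomial.natDegree_sum_le_of_forall_le _ _ fun j _ => ?_
  exact (Polynomial.natDegree_C_mul_X_pow_le _ _).trans j.2

/-- This is the scaling of a quadratic form by `|z|²` under multiplication by `z = a + bi`, with the
complex vector `x + iy` written in real and imaginary parts. -/
theorem quadratic_combination {k : ℕ} (V : Matrix (Fin k) (Fin k) ℝ)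
    (x y : Fin k → ℝ) (a b : ℝ) :
    (a • x - b • y) ⬝ᵥ V.mulVec (a • x - b • y) + (b • x + a • y) ⬝ᵥ V.mulVec (b • x + a • y) =
      (a ^ 2 + b ^ 2) * (x ⬝ᵥ V.mulVec x + y ⬝ᵥ V.mulVec y) := by
  simp only [Matrix.mulVec_add, Matrix.mulVec_sub, Matrix.mulVec_smul, dotProduct_add,
    dotProduct_sub, add_dotProduct, sub_dotProduct, smul_dotProduct, dotProduct_smul, smul_eq_mul]
  ring

/-- A root `z` of the polynomial is an eigenvalue of the companion matrix. On the eigenvector the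
Lyapunov inequality reads `|z|² q ≤ lam * q` with `q > 0`, which excludes `|z| ≥ 1`. -/
theorem noZeroOutside_of_lyapunov {k : ℕ} {S : Set (Fin k → ℝ)} (hS : HasCommonLyapunov S)
    {c : Fin k → ℝ} (hc : c ∈ S) : NoZeroOutside (1 + shiftSum c) := by
  obtain ⟨lam, -, hlam1, V, hV, hL⟩ := hS
  intro z hz hroot
  have hz0 : z ≠ 0 := by rintro rfl; simp at hz; linarith
  have hroot' : ∑ j : Fin k, (-c j : ℂ) * z⁻¹ ^ ((j : ℕ) + 1) = 1 := by
    simp only [shiftSum, map_add, map_one, map_sum, map_mul, map_pow, Polynomial.aeval_C,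
      Polynomial.aeval_X] at hroot
    simp only [neg_mul, Finset.sum_neg_distrib]
    have : (algebraMap ℝ ℂ) = Complex.ofRealHom := rfl
    rw [this] at hroot
    simp only [Complex.ofRealHom_eq_coe] at hroot
    linear_combination -hroot
  have hk : 0 < k := by
    rcases Nat.eq_zero_or_pos k with rfl | h
    · simp at hroot'
    · exact h
  -- The eigenvector for `z` is `(1, z⁻¹, z⁻², …)`. The first row of the eigenvalue equation is the
  -- root equation, and the other rows shift.
  set v : Fin k → ℂ := fun j => z⁻¹ ^ (j : ℕ) with hv
  set x : Fin k → ℝ := fun j => (v j).re with hx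
  set y : Fin k → ℝ := fun j => (v j).im with hy
  have heig : ∀ i, ∑ j, (companion c i j : ℂ) * v j = z * v i := by
    intro i
    by_cases hi : (i : ℕ) = 0
    · simp only [companion, Matrix.of_apply, hi, if_true, hv, pow_zero, mul_one]
      calc _ = z * ∑ j : Fin k, (-c j : ℂ) * z⁻¹ ^ ((j : ℕ) + 1) := by
            rw [Finset.mul_sum]
            refine Finset.sum_congr rfl fun j _ => ?_
            push_cast
            rw [pow_succ]
            field_simp
        _ = z := by rw [hroot', mul_one]
    · have hi' : (i : ℕ) - 1 < k := by omega
      rw [Finset.sum_eq_single (⟨(i : ℕ) - 1, hi'⟩ : Fin k)]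
      · simp only [companion, Matrix.of_apply, hi, if_false, hv]
        rw [if_pos (by omega)]
        obtain ⟨i', h⟩ := Nat.exists_eq_succ_of_ne_zero hi
        rw [h, Nat.succ_sub_one, pow_succ]
        field_simp
        simp
      · intro j _ hj
        simp only [companion, Matrix.of_apply, hi, if_false]
        rw [if_neg]
        · simp
        · intro h
          exact hj (Fin.ext (by simp; omega))
      · simp
  have hCx : (companion c).mulVec x = z.re • x - z.im • y := by
    ext i
    have := congrArg Complex.re (heig i)
    simpa [Matrix.mulVec, dotProduct, hx, hy] using this
  have hCy : (companion c).mulVec y = z.im • x + z.re • y := by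
    ext i
    have := congrArg Complex.im (heig i)
    simp only [Complex.im_sum, Complex.mul_im, Complex.ofReal_re, Complex.ofReal_im] at this
    simp only [Matrix.mulVec, dotProduct, hx, hy, Pi.add_apply, Pi.smul_apply, smul_eq_mul]
    simpa [add_comm] using this
  have hq : ∀ w : Fin k → ℝ, (companion c).mulVec w ⬝ᵥ V.mulVec ((companion c).mulVec w) ≤
      lam * (w ⬝ᵥ V.mulVec w) := by
    intro w
    have := (hL c hc).dotProduct_mulVec_nonneg w
    rw [Matrix.sub_mulVec, dotProduct_sub, Matrix.smul_mulVec, dotProduct_smul,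
      ← Matrix.mulVec_mulVec, ← Matrix.mulVec_mulVec, Matrix.dotProduct_mulVec _ (Matrix.transpose _),
      Matrix.vecMul_transpose] at this
    simp only [star_trivial, smul_eq_mul] at this
    linarith
  have hsum := add_le_add (hq x) (hq y)
  rw [hCx, hCy, quadratic_combination V, ← mul_add] at hsum
  -- The first entry of the eigenvector is the real number `1`.
  have hx0 : x ≠ 0 := by
    intro h
    have := congrFun h ⟨0, hk⟩
    simp [hx, hv] at this
  have hxpos : 0 < x ⬝ᵥ V.mulVec x := by simpa using hV.dotProduct_mulVec_pos hx0
  have hypos : 0 ≤ y ⬝ᵥ V.mulVec y := by simpa using hV.posSemidef.dotProduct_mulVec_nonneg y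
  have hz2 : 1 ≤ z.re ^ 2 + z.im ^ 2 := by
    have h1 : ‖z‖ ^ 2 = z.re ^ 2 + z.im ^ 2 := by
      rw [Complex.sq_norm, Complex.normSq_apply]; ring
    rw [← h1]
    exact one_le_pow₀ hz
  nlinarith

end LTI

end

/-! ### The input generator: impulse response, stability, excitation -/

noncomputable section

namespace LTI

variable {R : Type*} {m : ℕ}

/-- The impulse response of the input generator. -/
def genImpulse (gen : InputGenerator R m) (r : R) : PowerSeries ℝ :=
  PowerSeries.mk fun n =>
    if n = 0 then gen.Dz r else gen.Cz r ⬝ᵥ (gen.Az r ^ (n - 1)).mulVec (gen.Bz r)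

theorem genState_eq_sum (gen : InputGenerator R m) (r : R) (s : ℕ → ℝ) (n : ℕ) :
    genState gen r s n =
      ∑ k ∈ Finset.range n, s k • (gen.Az r ^ (n - 1 - k)).mulVec (gen.Bz r) := by
  induction n with
  | zero => simp [genState]
  | succ n ih =>
    rw [genState, ih, Finset.sum_range_succ, Matrix.mulVec_sum]
    congr 1
    · refine Finset.sum_congr rfl fun k hk => ?_
      rw [Matrix.mulVec_smul, Matrix.mulVec_mulVec, ← pow_succ']
      have := Finset.mem_range.1 hk
      congr 3
      omega
    · simp

theorem mk_input (gen : InputGenerator R m) (r : R) (s : ℕ → ℝ) :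
    PowerSeries.mk (input gen r s) = genImpulse gen r * PowerSeries.mk s := by
  ext n
  rw [mul_comm, PowerSeries.coeff_mul, PowerSeries.coeff_mk,
    Finset.Nat.sum_antidiagonal_eq_sum_range_succ
      (fun i j => PowerSeries.coeff i (PowerSeries.mk s) * PowerSeries.coeff j (genImpulse gen r)),
    Finset.sum_range_succ, input, genState_eq_sum, dotProduct_sum]
  simp only [genImpulse, PowerSeries.coeff_mk, Nat.sub_self, if_true]
  congr 1
  · refine Finset.sum_congr rfl fun k hk => ?_
    have := Finset.mem_range.1 hk
    rw [if_neg (by omega), dotProduct_smul, smul_eq_mul, Nat.sub_right_comm]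
  · ring

section Stability

-- Any submultiplicative norm would do: it only serves to make the matrices a Banach algebra.
attribute [local instance] Matrix.linftyOpNormedRing Matrix.linftyOpNormedAlgebra

/-- By Gelfand's formula `‖a ^ n‖ ^ (1 / n)` is eventually below some `c < 1`, so a geometric series
dominates. -/
theorem summable_norm_pow_of_spectralRadius_lt_one {A : Type*} [NormedRing A] [NormedAlgebra ℂ A]
    [CompleteSpace A] {a : A} (h : spectralRadius ℂ a < 1) : Summable fun n => ‖a ^ n‖ := by
  obtain ⟨c, hac, hc1⟩ := ENNReal.lt_iff_exists_nnreal_btwn.1 h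
  have hc1' : (c : ℝ) < 1 := by exact_mod_cast hc1
  have hev := (spectrum.pow_nnnorm_pow_one_div_tendsto_nhds_spectralRadius a).eventually_lt_const hac
  refine Summable.of_norm_bounded_eventually_nat (g := fun n => (c : ℝ) ^ n)
    (summable_geometric_of_lt_one c.2 hc1') ?_
  filter_upwards [hev, eventually_ne_atTop 0] with n hn hn0
  rw [norm_norm]
  have h1 : (‖a ^ n‖₊ : ENNReal) ≤ (c : ENNReal) ^ n := by
    have h2 := ENNReal.rpow_le_rpow hn.le (z := (n : ℝ)) (by positivity)
    rwa [← ENNReal.rpow_mul, one_div, inv_mul_cancel₀ (by exact_mod_cast hn0), ENNReal.rpow_one,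
      ENNReal.rpow_natCast] at h2
  exact_mod_cast h1

theorem summable_norm_linearMap_pow {A : Type*} [NormedRing A] [NormedAlgebra ℂ A]
    [FiniteDimensional ℂ A] {a : A} (h : spectralRadius ℂ a < 1) (φ : A →ₗ[ℂ] ℂ) :
    Summable fun n => ‖φ (a ^ n)‖ := by
  have : CompleteSpace A := FiniteDimensional.complete ℂ A
  refine Summable.of_nonneg_of_le (fun _ => norm_nonneg _) (fun n => ?_)
    ((summable_norm_pow_of_spectralRadius_lt_one h).mul_left ‖LinearMap.toContinuousLinearMap φ‖)
  exact (LinearMap.toContinuousLinearMap φ).le_opNorm _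

/-- Constant words `M ^ n` are among the products, and `ρ(M) ^ n ≤ ρ(M ^ n)`. The length `n = 0` is
left out because the exponent `1 / n` has no meaning there. -/
theorem spectralRadius_le_jointSpectralRadius {S : Set (Matrix (Fin m) (Fin m) ℝ)}
    {M : Matrix (Fin m) (Fin m) ℝ} (hM : M ∈ S) :
    spectralRadius ℂ (M.map Complex.ofReal) ≤ jointSpectralRadius S := by
  refine le_limsup_of_frequently_le ?_ (by isBoundedDefault)
  refine Eventually.frequently ?_
  filter_upwards [eventually_ne_atTop 0] with n hn
  have hpow : (M ^ n).map Complex.ofReal = (M.map Complex.ofReal) ^ n :=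
    map_pow (Complex.ofRealHom.mapMatrix) M n
  refine le_iSup_of_le ⟨List.replicate n M, List.length_replicate, fun N hN => ?_⟩ ?_
  · rw [List.eq_of_mem_replicate hN]; exact hM
  · rw [List.prod_replicate, hpow]
    have h := ENNReal.rpow_le_rpow (spectrum.spectralRadius_pow_le (𝕜 := ℂ) (M.map Complex.ofReal) n hn)
      (z := 1 / (n : ℝ)) (by positivity)
    rwa [← ENNReal.rpow_natCast, ← ENNReal.rpow_mul, mul_one_div_cancel (by exact_mod_cast hn),
      ENNReal.rpow_one] at h

theorem absSummable_genImpulse (gen : InputGenerator R m) (r : R)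
    (h : spectralRadius ℂ ((gen.Az r).map Complex.ofReal) < 1) :
    AbsSummable (genImpulse gen r) := by
  set A : Matrix (Fin m) (Fin m) ℂ := (gen.Az r).map Complex.ofReal with hA
  let φ : Matrix (Fin m) (Fin m) ℂ →ₗ[ℂ] ℂ :=
    { toFun := fun M => (fun i => (gen.Cz r i : ℂ)) ⬝ᵥ M.mulVec fun i => (gen.Bz r i : ℂ)
      map_add' := fun M N => by simp [Matrix.add_mulVec, dotProduct_add]
      map_smul' := fun c M => by simp [Matrix.smul_mulVec, dotProduct_smul] }
  have hφ : ∀ n, ‖gen.Cz r ⬝ᵥ (gen.Az r ^ n).mulVec (gen.Bz r)‖ = ‖φ (A ^ n)‖ := by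
    intro n
    have hpow : (gen.Az r ^ n).map Complex.ofReal = A ^ n :=
      map_pow (Complex.ofRealHom.mapMatrix) (gen.Az r) n
    have : φ (A ^ n) = ((gen.Cz r ⬝ᵥ (gen.Az r ^ n).mulVec (gen.Bz r) : ℝ) : ℂ) := by
      rw [← hpow]
      simp [φ, dotProduct, Matrix.mulVec]
    rw [this, Complex.norm_real]
  rw [AbsSummable, ← summable_nat_add_iff 1]
  refine (summable_norm_linearMap_pow h φ).congr fun n => ?_
  rw [genImpulse, PowerSeries.coeff_mk, if_neg (Nat.succ_ne_zero n), Nat.add_sub_cancel, hφ]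

end Stability

/-- By Cayley–Hamilton the resolvent, where it exists, is a polynomial in `A`, so it is invisible
between `c` and `b` if all powers of `A` are. -/
theorem dotProduct_inv_mulVec_eq_zero {K : Type*} [Field K] (A : Matrix (Fin m) (Fin m) K)
    (b c : Fin m → K) (h : ∀ n : ℕ, c ⬝ᵥ (A ^ n).mulVec b = 0) (z : K) :
    c ⬝ᵥ ((z • (1 : Matrix (Fin m) (Fin m) K) - A)⁻¹).mulVec b = 0 := by
  set N : Matrix (Fin m) (Fin m) K := z • 1 - A with hN
  have hpoly : ∀ Q : Polynomial K, c ⬝ᵥ (Polynomial.aeval A Q).mulVec b = 0 := by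
    intro Q
    rw [Polynomial.aeval_eq_sum_range, Matrix.sum_mulVec, dotProduct_sum]
    refine Finset.sum_eq_zero fun i _ => ?_
    rw [Matrix.smul_mulVec, dotProduct_smul, h, smul_zero]
  by_cases hu : IsUnit N.det
  · have hNA : Polynomial.aeval A (Polynomial.C z - Polynomial.X) = N := by
      simp [hN, Algebra.algebraMap_eq_smul_one]
    obtain ⟨Q, hQ⟩ : ∃ Q : Polynomial K, N⁻¹ = Polynomial.aeval N Q := by
      have hp0 : N.charpoly.coeff 0 ≠ 0 := by
        intro h
        rw [Matrix.det_eq_sign_charpoly_coeff, h, mul_zero] at hu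
        exact not_isUnit_zero hu
      -- With `χ = X * q + c₀` the characteristic polynomial, `χ(N) = 0` gives `N * q(N) = -c₀`, and
      -- `c₀` is the determinant up to sign.
      refine ⟨Polynomial.C (-(N.charpoly.coeff 0)⁻¹) * N.charpoly.divX, Matrix.inv_eq_right_inv ?_⟩
      have hCH := N.aeval_self_charpoly
      rw [← Polynomial.X_mul_divX_add (N.charpoly), map_add, map_mul, Polynomial.aeval_X,
        Polynomial.aeval_C, add_eq_zero_iff_eq_neg] at hCH
      rw [map_mul, Polynomial.aeval_C, Algebra.left_comm, hCH, Algebra.algebraMap_eq_smul_one,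
        Algebra.algebraMap_eq_smul_one]
      rw [neg_smul, neg_mul_neg, smul_mul_assoc, one_mul, smul_smul, inv_mul_cancel₀ hp0, one_smul]
    rw [hQ, ← hNA, ← Polynomial.aeval_comp]
    exact hpoly _
  -- The inverse of a singular matrix is `0` by convention.
  · rw [Matrix.nonsing_inv_apply_not_isUnit _ hu]
    simp

/-- The coefficients of the impulse response are `D_z` and `C_z A_z ^ n B_z`. If they all vanish, so
does the transfer function at every point, so a single excited frequency is enough. -/
theorem genImpulse_ne_zero (gen : InputGenerator R m) (r : R) (w : ℝ)
    (hw : 0 < inputSpectrum gen r w) : genImpulse gen r ≠ 0 := by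
  intro h0
  have hD : gen.Dz r = 0 := by
    simpa [genImpulse] using congrArg (PowerSeries.coeff 0) h0
  have hC : ∀ n : ℕ, gen.Cz r ⬝ᵥ (gen.Az r ^ n).mulVec (gen.Bz r) = 0 := by
    intro n
    simpa [genImpulse] using congrArg (PowerSeries.coeff (n + 1)) h0
  have hz : genTransfer gen r (Complex.exp (Complex.I * w)) = 0 := by
    rw [genTransfer, hD, dotProduct_inv_mulVec_eq_zero, Complex.ofReal_zero, add_zero]
    intro n
    have hpow : (gen.Az r ^ n).map Complex.ofReal = ((gen.Az r).map Complex.ofReal) ^ n :=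
      map_pow (Complex.ofRealHom.mapMatrix) (gen.Az r) n
    rw [← hpow]
    have := congrArg Complex.ofReal (hC n)
    simpa [dotProduct, Matrix.mulVec] using this
  rw [inputSpectrum, hz] at hw
  simp at hw

end LTI

end

/-! ### Coefficientwise calculus of families of power series -/

noncomputable section

namespace LTI

section SeriesCalculus

variable {E : Type*} [NormedAddCommGroup E] [NormedSpace ℝ E]

/-- The geometric series for `φ⁻¹`, truncated: the remainder is divisible by `X ^ (n + 1)`. Each
coefficient of the inverse is thus a polynomial in coefficients of `φ`, which is what makes
inversion differentiable. -/
theorem coeff_inv_eq_sum {φ : PowerSeries ℝ} (h : PowerSeries.constantCoeff φ = 1) (n : ℕ) :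
    PowerSeries.coeff n φ⁻¹ = ∑ k ∈ Finset.range (n + 1), PowerSeries.coeff n ((1 - φ) ^ k) := by
  have hinv : φ * φ⁻¹ = 1 := PowerSeries.mul_inv_cancel _ (by rw [h]; exact one_ne_zero)
  have hgeom := mul_neg_geom_sum (1 - φ) (n + 1)
  rw [sub_sub_cancel] at hgeom
  have hsum : ∑ k ∈ Finset.range (n + 1), (1 - φ) ^ k = φ⁻¹ - (1 - φ) ^ (n + 1) * φ⁻¹ := by
    linear_combination φ⁻¹ * hgeom - (∑ k ∈ Finset.range (n + 1), (1 - φ) ^ k) * hinv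
  have hdvd : PowerSeries.X ^ (n + 1) ∣ (1 - φ) ^ (n + 1) * φ⁻¹ := by
    refine Dvd.dvd.mul_right (pow_dvd_pow_of_dvd ?_ _) _
    rw [PowerSeries.X_dvd_iff]
    simp [h]
  rw [← map_sum, hsum, map_sub, PowerSeries.X_pow_dvd_iff.1 hdvd n (Nat.lt_succ_self n), sub_zero]

/-- Coefficientwise continuity of a family of power series. -/
def SeriesContAt {E : Type*} [TopologicalSpace E] (f : E → PowerSeries ℝ) (x : E) : Prop :=
  ∀ n, ContinuousAt (fun y => PowerSeries.coeff n (f y)) x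

/-- Coefficientwise differentiability of a family of power series, with derivative `f' v` in the
direction `v`. -/
def HasSeriesDerivAt (f f' : E → PowerSeries ℝ) (x : E) : Prop :=
  ∀ n, DifferentiableAt ℝ (fun y => PowerSeries.coeff n (f y)) x ∧
    ∀ v, fderiv ℝ (fun y => PowerSeries.coeff n (f y)) x v = PowerSeries.coeff n (f' v)

theorem SeriesContAt.mul {E : Type*} [TopologicalSpace E] {f g : E → PowerSeries ℝ} {x : E}
    (hf : SeriesContAt f x) (hg : SeriesContAt g x) : SeriesContAt (fun y => f y * g y) x := by
  intro n
  simp only [PowerSeries.coeff_mul]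
  exact tendsto_finsetSum _ fun i _ => (hf i.1).mul (hg i.2)

theorem SeriesContAt.add {E : Type*} [TopologicalSpace E] {f g : E → PowerSeries ℝ} {x : E}
    (hf : SeriesContAt f x) (hg : SeriesContAt g x) : SeriesContAt (fun y => f y + g y) x := by
  intro n
  simp only [map_add]
  exact (hf n).add (hg n)

theorem SeriesContAt.sub {E : Type*} [TopologicalSpace E] {f g : E → PowerSeries ℝ} {x : E}
    (hf : SeriesContAt f x) (hg : SeriesContAt g x) : SeriesContAt (fun y => f y - g y) x := by
  intro n
  simp only [map_sub]
  exact (hf n).sub (hg n)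

theorem SeriesContAt.const {E : Type*} [TopologicalSpace E] (φ : PowerSeries ℝ) (x : E) :
    SeriesContAt (fun _ => φ) x :=
  fun _ => continuousAt_const

namespace HasSeriesDerivAt

variable {f f' g g' : E → PowerSeries ℝ} {x : E}

theorem seriesContAt (hf : HasSeriesDerivAt f f' x) : SeriesContAt f x :=
  fun n => (hf n).1.continuousAt

theorem congr_deriv {f'' : E → PowerSeries ℝ} (hf : HasSeriesDerivAt f f' x)
    (h : ∀ v, f' v = f'' v) : HasSeriesDerivAt f f'' x :=
  (funext h : f' = f'') ▸ hf

theorem const (φ : PowerSeries ℝ) : HasSeriesDerivAt (fun _ => φ) (fun _ => 0) x :=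
  fun n => ⟨differentiableAt_const _, fun v => by simp⟩

theorem linear [FiniteDimensional ℝ E] (l : E →ₗ[ℝ] PowerSeries ℝ) (x : E) :
    HasSeriesDerivAt l l x := by
  intro n
  have h : HasFDerivAt (fun y => PowerSeries.coeff n (l y))
      (LinearMap.toContinuousLinearMap ((PowerSeries.coeff n).comp l)) x :=
    (LinearMap.toContinuousLinearMap ((PowerSeries.coeff n).comp l)).hasFDerivAt
  exact ⟨h.differentiableAt, fun v => by rw [h.fderiv]; rfl⟩

theorem add (hf : HasSeriesDerivAt f f' x) (hg : HasSeriesDerivAt g g' x) :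
    HasSeriesDerivAt (fun y => f y + g y) (fun v => f' v + g' v) x := by
  intro n
  simp only [map_add]
  refine ⟨(hf n).1.add (hg n).1, fun v => ?_⟩
  rw [fderiv_fun_add (hf n).1 (hg n).1, add_apply, (hf n).2, (hg n).2]

theorem sub (hf : HasSeriesDerivAt f f' x) (hg : HasSeriesDerivAt g g' x) :
    HasSeriesDerivAt (fun y => f y - g y) (fun v => f' v - g' v) x := by
  intro n
  simp only [map_sub]
  refine ⟨(hf n).1.sub (hg n).1, fun v => ?_⟩
  rw [fderiv_fun_sub (hf n).1 (hg n).1, sub_apply, (hf n).2, (hg n).2]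

theorem mul (hf : HasSeriesDerivAt f f' x) (hg : HasSeriesDerivAt g g' x) :
    HasSeriesDerivAt (fun y => f y * g y) (fun v => f' v * g x + f x * g' v) x := by
  intro n
  simp only [map_add, PowerSeries.coeff_mul]
  have h : ∀ i ∈ Finset.HasAntidiagonal.antidiagonal n, DifferentiableAt ℝ
      (fun y => PowerSeries.coeff i.1 (f y) * PowerSeries.coeff i.2 (g y)) x :=
    fun i _ => (hf i.1).1.mul (hg i.2).1
  refine ⟨DifferentiableAt.fun_sum h, fun v => ?_⟩
  rw [fderiv_fun_sum h, sum_apply, ← Finset.sum_add_distrib]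
  refine Finset.sum_congr rfl fun i _ => ?_
  rw [fderiv_fun_mul (hf i.1).1 (hg i.2).1]
  simp only [add_apply, smul_apply, smul_eq_mul, (hf i.1).2, (hg i.2).2]
  ring

/-- The truncated geometric series gives differentiability. The derivative is then found by
differentiating `f * f⁻¹ = 1`. -/
theorem inv (hf : HasSeriesDerivAt f f' x) (h1 : ∀ y, PowerSeries.constantCoeff (f y) = 1) :
    HasSeriesDerivAt (fun y => (f y)⁻¹) (fun v => -(f' v * (f x)⁻¹ ^ 2)) x := by
  have hpow : ∀ k : ℕ, ∃ d, HasSeriesDerivAt (fun y => (1 - f y) ^ k) d x := by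
    intro k
    induction k with
    | zero => exact ⟨_, by simpa using const 1⟩
    | succ k ih =>
      obtain ⟨d, hd⟩ := ih
      exact ⟨_, by simpa only [pow_succ] using hd.mul ((const 1).sub hf)⟩
  choose d hd using hpow
  have hdiff : ∀ n, DifferentiableAt ℝ (fun y => PowerSeries.coeff n (f y)⁻¹) x := by
    intro n
    simp only [fun y => coeff_inv_eq_sum (h1 y) n]
    exact DifferentiableAt.fun_sum fun k _ => (hd k n).1
  -- The derivative enters as an unknown series, to be solved for from the product rule.
  have hi : HasSeriesDerivAt (fun y => (f y)⁻¹)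
      (fun v => PowerSeries.mk fun n => fderiv ℝ (fun y => PowerSeries.coeff n (f y)⁻¹) x v) x :=
    fun n => ⟨hdiff n, fun v => by rw [PowerSeries.coeff_mk]⟩
  have hcancel : ∀ y, f y * (f y)⁻¹ = 1 := fun y =>
    PowerSeries.mul_inv_cancel _ (by rw [h1]; exact one_ne_zero)
  refine hi.congr_deriv fun v => ?_
  have hprod := hf.mul hi
  simp only [hcancel] at hprod
  have hzero : f' v * (f x)⁻¹ + f x * (PowerSeries.mk fun n =>
      fderiv ℝ (fun y => PowerSeries.coeff n (f y)⁻¹) x v) = 0 := by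
    ext n
    rw [← (hprod n).2 v]
    simp
  linear_combination (f x)⁻¹ * hzero - (PowerSeries.mk fun n =>
      fderiv ℝ (fun y => PowerSeries.coeff n (f y)⁻¹) x v) * hcancel x

end HasSeriesDerivAt

end SeriesCalculus

/-! ### The gradient of the prediction error -/

variable {p : Orders}

/-- `∑ x_j X^j` as a linear function of `x`. -/
def shiftLin (k : ℕ) : (Fin k → ℝ) →ₗ[ℝ] PowerSeries ℝ where
  toFun x := filt (shiftSum x)
  map_add' x y := by
    simp [filt, shiftSum, add_mul, Finset.sum_add_distrib, ← Polynomial.coe_add]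
  map_smul' c x := by
    rw [filt, filt, RingHom.id_apply, ← Polynomial.coe_smul]
    simp [shiftSum, mul_assoc, Finset.mul_sum, Polynomial.smul_eq_C_mul]

def varA : Param p →ₗ[ℝ] PowerSeries ℝ :=
  (shiftLin p.a).comp (LinearMap.pi fun j => LinearMap.proj (.inl j))
def varB : Param p →ₗ[ℝ] PowerSeries ℝ :=
  (shiftLin p.b).comp (LinearMap.pi fun j => LinearMap.proj (.inr (.inl j)))
def varF : Param p →ₗ[ℝ] PowerSeries ℝ :=
  (shiftLin p.f).comp (LinearMap.pi fun j => LinearMap.proj (.inr (.inr (.inl j))))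
def varC : Param p →ₗ[ℝ] PowerSeries ℝ :=
  (shiftLin p.c).comp (LinearMap.pi fun j => LinearMap.proj (.inr (.inr (.inr (.inl j)))))
def varD : Param p →ₗ[ℝ] PowerSeries ℝ :=
  (shiftLin p.d).comp (LinearMap.pi fun j => LinearMap.proj (.inr (.inr (.inr (.inr j)))))

theorem varA_apply (v : Param p) : varA v = filt (shiftSum (parA v)) := rfl
theorem varB_apply (v : Param p) : varB v = filt (shiftSum (parB v)) := rfl
theorem varF_apply (v : Param p) : varF v = filt (shiftSum (parF v)) := rfl
theorem varC_apply (v : Param p) : varC v = filt (shiftSum (parC v)) := rfl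
theorem varD_apply (v : Param p) : varD v = filt (shiftSum (parD v)) := rfl

theorem filt_one_add (P : Polynomial ℝ) : filt (1 + P) = 1 + filt P := by simp [filt]

theorem hasSeriesDerivAt_one_add (l : Param p →ₗ[ℝ] PowerSeries ℝ) (θ : Param p) :
    HasSeriesDerivAt (fun θ => 1 + l θ) l θ :=
  ((HasSeriesDerivAt.const 1).add (.linear l θ)).congr_deriv fun _ => zero_add _

theorem hasSeriesDerivAt_filt_polyA (θ : Param p) :
    HasSeriesDerivAt (fun θ => filt (polyA θ)) varA θ := by
  simpa only [polyA, filt_one_add, varA_apply] using hasSeriesDerivAt_one_add varA θ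
theorem hasSeriesDerivAt_filt_polyB (θ : Param p) :
    HasSeriesDerivAt (fun θ => filt (polyB θ)) varB θ :=
  HasSeriesDerivAt.linear varB θ
theorem hasSeriesDerivAt_filt_polyF (θ : Param p) :
    HasSeriesDerivAt (fun θ => filt (polyF θ)) varF θ := by
  simpa only [polyF, filt_one_add, varF_apply] using hasSeriesDerivAt_one_add varF θ
theorem hasSeriesDerivAt_filt_polyC (θ : Param p) :
    HasSeriesDerivAt (fun θ => filt (polyC θ)) varC θ := by
  simpa only [polyC, filt_one_add, varC_apply] using hasSeriesDerivAt_one_add varC θ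
theorem hasSeriesDerivAt_filt_polyD (θ : Param p) :
    HasSeriesDerivAt (fun θ => filt (polyD θ)) varD θ := by
  simpa only [polyD, filt_one_add, varD_apply] using hasSeriesDerivAt_one_add varD θ

theorem constantCoeff_filt_one_add {k : ℕ} (x : Fin k → ℝ) :
    PowerSeries.constantCoeff (filt (1 + shiftSum x)) = 1 := by
  rw [← PowerSeries.coeff_zero_eq_constantCoeff_apply, filt, Polynomial.coeff_coe,
    Polynomial.coeff_add, coeff_zero_shiftSum]
  simp

theorem filt_one_add_mul_inv {k : ℕ} (x : Fin k → ℝ) :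
    filt (1 + shiftSum x) * (filt (1 + shiftSum x))⁻¹ = 1 :=
  PowerSeries.mul_inv_cancel _ (by rw [constantCoeff_filt_one_add]; exact one_ne_zero)

theorem hasSeriesDerivAt_filt_polyC_inv (θ : Param p) :
    HasSeriesDerivAt (fun θ => (filt (polyC θ))⁻¹)
      (fun v => -(varC v * (filt (polyC θ))⁻¹ ^ 2)) θ :=
  (hasSeriesDerivAt_filt_polyC θ).inv fun _ => constantCoeff_filt_one_add _
theorem hasSeriesDerivAt_filt_polyF_inv (θ : Param p) :
    HasSeriesDerivAt (fun θ => (filt (polyF θ))⁻¹)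
      (fun v => -(varF v * (filt (polyF θ))⁻¹ ^ 2)) θ :=
  (hasSeriesDerivAt_filt_polyF θ).inv fun _ => constantCoeff_filt_one_add _

/-- The filter from the output to the derivative of the prediction error in the direction `v`. -/
def gradY (θ v : Param p) : PowerSeries ℝ :=
  (varD v * filt (polyA θ) + filt (polyD θ) * varA v) * (filt (polyC θ))⁻¹ -
    filt (polyD θ) * filt (polyA θ) * (varC v * ((filt (polyC θ))⁻¹ * (filt (polyC θ))⁻¹))

/-- The filter from the input to the derivative of the prediction error in the direction `v`. -/
def gradU (θ v : Param p) : PowerSeries ℝ :=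
  filt (polyD θ) * filt (polyB θ) *
      (varC v * ((filt (polyC θ))⁻¹ * (filt (polyC θ))⁻¹) * (filt (polyF θ))⁻¹ +
        varF v * ((filt (polyF θ))⁻¹ * (filt (polyF θ))⁻¹) * (filt (polyC θ))⁻¹) -
    (varD v * filt (polyB θ) + filt (polyD θ) * varB v) *
      ((filt (polyC θ))⁻¹ * (filt (polyF θ))⁻¹)

/-- The `1` in the predictor cancels `y`. The inverse of `C F` is split so that each factor can be
differentiated separately. -/
theorem predError_eq_coeff (θ : Param p) (u y : ℕ → ℝ) (n : ℕ) :
    predError θ u y n = PowerSeries.coeff n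
      (filt (polyD θ) * filt (polyA θ) * (filt (polyC θ))⁻¹ * PowerSeries.mk y -
        filt (polyD θ) * filt (polyB θ) * ((filt (polyC θ))⁻¹ * (filt (polyF θ))⁻¹) *
          PowerSeries.mk u) := by
  have hy : y n = PowerSeries.coeff n (PowerSeries.mk y) := by rw [PowerSeries.coeff_mk]
  rw [predError, predictor, hy, ← map_sub, PowerSeries.mul_inv_rev]
  congr 1
  ring

theorem hasSeriesDerivAt_predError (θ : Param p) (U Y : PowerSeries ℝ) :
    HasSeriesDerivAt (fun θ => filt (polyD θ) * filt (polyA θ) * (filt (polyC θ))⁻¹ * Y -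
        filt (polyD θ) * filt (polyB θ) * ((filt (polyC θ))⁻¹ * (filt (polyF θ))⁻¹) * U)
      (fun v => gradY θ v * Y + gradU θ v * U) θ := by
  have hA := hasSeriesDerivAt_filt_polyA θ
  have hB := hasSeriesDerivAt_filt_polyB θ
  have hD := hasSeriesDerivAt_filt_polyD θ
  have hC := hasSeriesDerivAt_filt_polyC_inv θ
  have hF := hasSeriesDerivAt_filt_polyF_inv θ
  refine ((((hD.mul hA).mul hC).mul (.const Y)).sub
    (((hD.mul hB).mul (hC.mul hF)).mul (.const U))).congr_deriv fun v => ?_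
  rw [gradY, gradU]
  ring

theorem differentiableAt_predError (θ : Param p) (u y : ℕ → ℝ) (n : ℕ) :
    DifferentiableAt ℝ (fun θ' => predError θ' u y n) θ := by
  simp only [predError_eq_coeff]
  exact (hasSeriesDerivAt_predError θ _ _ n).1

theorem predErrorGrad_eq_coeff (θ : Param p) (u y : ℕ → ℝ) (n : ℕ) (i : Idx p) :
    predErrorGrad θ u y n i = PowerSeries.coeff n
      (gradY θ (Pi.single i 1) * PowerSeries.mk y + gradU θ (Pi.single i 1) * PowerSeries.mk u) := by
  simp only [predErrorGrad, predError_eq_coeff]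
  exact (hasSeriesDerivAt_predError θ _ _ n).2 _

/-- The transfer function from the driving noise `s` to the derivative of the prediction error in
the direction `v`, for the true parameter `θs` and an input with impulse response `g`. -/
def gradS (θs : Param p) (g : PowerSeries ℝ) (θ : Param p) : Param p →ₗ[ℝ] PowerSeries ℝ where
  toFun v := (gradY θ v * ((filt (polyA θs))⁻¹ * filt (polyB θs) * (filt (polyF θs))⁻¹) +
    gradU θ v) * g
  map_add' v w := by
    simp only [gradY, gradU, map_add]
    ring
  map_smul' c v := by
    simp only [gradY, gradU, map_smul, PowerSeries.smul_eq_C_mul, RingHom.id_apply]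
    ring

/-- The transfer function from the noise `e` to the derivative of the prediction error in the
direction `v`. -/
def gradE (θs θ : Param p) : Param p →ₗ[ℝ] PowerSeries ℝ where
  toFun v := gradY θ v * ((filt (polyA θs))⁻¹ * filt (polyC θs) * (filt (polyD θs))⁻¹)
  map_add' v w := by
    simp only [gradY, map_add]
    ring
  map_smul' c v := by
    simp only [gradY, map_smul, PowerSeries.smul_eq_C_mul, RingHom.id_apply]
    ring

variable {R Ω : Type*} {m : ℕ}

/-- Superposition: the output is eliminated through the true system and the input through its
generator. Neither depends on the variable of differentiation, because `r` is frozen. -/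
theorem errGradProc_eq_coeff (θs : Param p) (gen : InputGenerator R m) (r : R)
    (e s : ℕ → Ω → ℝ) (θ : Param p) (n : ℕ) (ω : Ω) (i : Idx p) :
    errGradProc θs gen r e s θ n ω i = PowerSeries.coeff n
      (gradS θs (genImpulse gen r) θ (Pi.single i 1) * PowerSeries.mk (fun k => s k ω) +
        gradE θs θ (Pi.single i 1) * PowerSeries.mk (fun k => e k ω)) := by
  have hy : PowerSeries.mk (outputProc θs gen r e s ω) =
      (filt (polyA θs))⁻¹ * (filt (polyB θs) * (filt (polyF θs))⁻¹ *
        PowerSeries.mk (inputProc gen r s ω) +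
        filt (polyC θs) * (filt (polyD θs))⁻¹ * PowerSeries.mk (fun k => e k ω)) := by
    ext k
    rw [PowerSeries.coeff_mk]
    rfl
  rw [errGradProc, predErrorGrad_eq_coeff, hy, inputProc, mk_input]
  congr 1
  simp only [gradS, gradE, LinearMap.coe_mk, AddHom.coe_mk]
  ring

end LTI

end

/-! ### Algebra of identifiability: the tangent equations -/

noncomputable section

namespace LTI

section Algebra

open Polynomial

/-- By Bézout `A` divides `α * gcd B C`, and `A` is coprime to that gcd. -/
theorem dvd_of_dvd_mul_of_no_common_factor {K : Type*} [Field K] {A B C α : K[X]}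
    (h : ∀ d : K[X], d ∣ A → d ∣ B → d ∣ C → IsUnit d) (hB : A ∣ α * B) (hC : A ∣ α * C) :
    A ∣ α := by
  classical
  have hrel : IsRelPrime A (EuclideanDomain.gcd B C) := fun d hA hd =>
    h d hA (hd.trans (EuclideanDomain.gcd_dvd_left B C)) (hd.trans (EuclideanDomain.gcd_dvd_right B C))
  suffices A ∣ α * EuclideanDomain.gcd B C from hrel.dvd_of_dvd_mul_right this
  rw [EuclideanDomain.gcd_eq_gcd_ab, mul_add, ← mul_assoc, ← mul_assoc]
  exact dvd_add (hB.mul_right _) (hC.mul_right _)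

/-- A unit among `A`, `D`, `F` stands for a polynomial of order zero, for which the matching
coprimeness condition is not assumed. In the generic case `B` and `C` cancel, leaving `A ∣ α * F`
and `A ∣ α * D` with `F`, `D` coprime. -/
theorem dvd_of_identifiable {K : Type*} [Field K] {A B C D F α : K[X]}
    (h1 : ∀ d : K[X], d ∣ A → d ∣ B → d ∣ C → IsUnit d) (h4 : IsUnit A ∨ IsRelPrime F D)
    (h5 : IsUnit D ∨ IsRelPrime A B) (h6 : IsUnit F ∨ IsRelPrime A C)
    (hCD : A ∣ α * C * D) (hBF : A ∣ α * B * F) : A ∣ α := by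
  rcases h4 with hA | hFD
  · exact hA.dvd
  rcases h5 with hD | hAB
  · have hC := hD.dvd_mul_right.1 hCD
    rcases h6 with hF | hAC
    · exact dvd_of_dvd_mul_of_no_common_factor h1 (hF.dvd_mul_right.1 hBF) hC
    · exact hAC.dvd_of_dvd_mul_right hC
  · rcases h6 with hF | hAC
    · exact hAB.dvd_of_dvd_mul_right (hF.dvd_mul_right.1 hBF)
    · refine dvd_of_dvd_mul_of_no_common_factor (B := F) (C := D)
        (fun d _ hF hD => hFD hF hD) ?_ ?_
      · exact hAB.dvd_of_dvd_mul_right (by rwa [mul_right_comm] at hBF)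
      · exact hAC.dvd_of_dvd_mul_right (by rwa [mul_right_comm] at hCD)

/-- Under the coprimeness conditions, the tangent equations of the model structure have only the
zero solution. -/
theorem tangent_eq_zero {K : Type*} [Field K] {A B C D F α β γ δ φ : K[X]}
    (h1 : ∀ d : K[X], d ∣ A → d ∣ B → d ∣ C → IsUnit d)
    (h2 : IsRelPrime B F) (h3 : IsRelPrime C D) (h4 : IsUnit A ∨ IsRelPrime F D)
    (h5 : IsUnit D ∨ IsRelPrime A B) (h6 : IsUnit F ∨ IsRelPrime A C)
    (hα : α.degree < A.degree) (hδ : δ.degree < D.degree) (hφ : φ.degree < F.degree)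
    (he : α * C * D - γ * A * D + δ * A * C = 0) (hs : α * B * F - β * A * F + φ * A * B = 0) :
    α = 0 ∧ β = 0 ∧ γ = 0 ∧ δ = 0 ∧ φ = 0 := by
  have hA0 : A ≠ 0 := by rintro rfl; simp at hα
  have hD0 : D ≠ 0 := by rintro rfl; simp at hδ
  have hF0 : F ≠ 0 := by rintro rfl; simp at hφ
  -- Modulo `A`, only the `α` term survives in each tangent equation.
  have hα0 : α = 0 := by
    refine eq_zero_of_dvd_of_degree_lt (dvd_of_identifiable h1 h4 h5 h6 ?_ ?_) hα
    · exact ⟨γ * D - δ * C, by linear_combination he⟩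
    · exact ⟨β * F - φ * B, by linear_combination hs⟩
  subst hα0
  -- With `α = 0` a factor `A` cancels. Coprimeness then gives `D ∣ δ` and `F ∣ φ`, which the
  -- degrees forbid unless both vanish.
  have he' : δ * C = D * γ := mul_left_cancel₀ hA0 (by linear_combination he)
  have hs' : φ * B = F * β := mul_left_cancel₀ hA0 (by linear_combination hs)
  have hδ0 : δ = 0 :=
    eq_zero_of_dvd_of_degree_lt (h3.symm.dvd_of_dvd_mul_right ⟨γ, he'⟩) hδ
  have hφ0 : φ = 0 :=
    eq_zero_of_dvd_of_degree_lt (h2.symm.dvd_of_dvd_mul_right ⟨β, hs'⟩) hφ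
  subst hδ0 hφ0
  refine ⟨rfl, ?_, ?_, rfl, rfl⟩
  · simpa [hF0] using hs'.symm
  · simpa [hD0] using he'.symm

/-- The constant term becomes the coefficient of `z ^ k`: it is `1` for the model polynomial and `0`
for its variation. -/
theorem degree_reflect_shiftSum_lt {k : ℕ} (x y : Fin k → ℝ) :
    (reflect k (shiftSum x)).degree < (reflect k (1 + shiftSum y)).degree := by
  have h1 : (reflect k (shiftSum x)).degree < k := by
    rw [degree_lt_iff_coeff_zero]
    intro n hn
    rw [coeff_reflect]
    rcases hn.eq_or_lt with rfl | hn
    · rw [revAt_le le_rfl, Nat.sub_self, coeff_zero_shiftSum]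
    · rw [revAt_eq_self_of_lt hn]
      exact coeff_eq_zero_of_natDegree_lt ((natDegree_shiftSum_le x).trans_lt hn)
  refine h1.trans_le (le_degree_of_ne_zero ?_)
  rw [coeff_reflect, revAt_le le_rfl, Nat.sub_self, coeff_add, coeff_zero_shiftSum]
  simp

theorem natDegree_one_add_shiftSum_le {k : ℕ} (x : Fin k → ℝ) :
    (1 + shiftSum x).natDegree ≤ k :=
  (natDegree_add_le _ _).trans (by simp [natDegree_shiftSum_le])

theorem isUnit_reflect_of_order_zero {k : ℕ} (hk : k = 0) (x : Fin k → ℝ) :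
    IsUnit (reflect k (1 + shiftSum x)) := by
  subst hk
  have : reflect 0 (1 : ℝ[X]) = 1 := by
    simp
  simp [shiftSum, this]

theorem shiftSum_eq_zero {k : ℕ} {x : Fin k → ℝ} (h : shiftSum x = 0) (j : Fin k) : x j = 0 := by
  rw [← coeff_shiftSum x, h, coeff_zero]

theorem reflect_mul_mul {f g h : ℝ[X]} {a b c : ℕ} (hf : f.natDegree ≤ a) (hg : g.natDegree ≤ b)
    (hh : h.natDegree ≤ c) :
    reflect (a + b + c) (f * g * h) = reflect a f * reflect b g * reflect c h := by
  rw [reflect_mul _ _ (natDegree_mul_le_of_le hf hg) hh, reflect_mul _ _ hf hg]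

end Algebra

variable {p : Orders}

theorem eq_zero_of_tangent {θ v : Param p} (hid : Identifiable θ)
    (he : shiftSum (parA v) * polyC θ * polyD θ - shiftSum (parC v) * polyA θ * polyD θ +
      shiftSum (parD v) * polyA θ * polyC θ = 0)
    (hs : shiftSum (parA v) * polyB θ * polyF θ - shiftSum (parB v) * polyA θ * polyF θ +
      shiftSum (parF v) * polyA θ * polyB θ = 0) : v = 0 := by
  obtain ⟨h1, h2, h3, h4, h5, h6⟩ := hid
  have dA : (polyA θ).natDegree ≤ p.a := natDegree_one_add_shiftSum_le _
  have dB : (polyB θ).natDegree ≤ p.b := natDegree_shiftSum_le _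
  have dF : (polyF θ).natDegree ≤ p.f := natDegree_one_add_shiftSum_le _
  have dC : (polyC θ).natDegree ≤ p.c := natDegree_one_add_shiftSum_le _
  have dD : (polyD θ).natDegree ≤ p.d := natDegree_one_add_shiftSum_le _
  have vA : (shiftSum (parA v)).natDegree ≤ p.a := natDegree_shiftSum_le _
  have vB : (shiftSum (parB v)).natDegree ≤ p.b := natDegree_shiftSum_le _
  have vF : (shiftSum (parF v)).natDegree ≤ p.f := natDegree_shiftSum_le _
  have vC : (shiftSum (parC v)).natDegree ≤ p.c := natDegree_shiftSum_le _
  have vD : (shiftSum (parD v)).natDegree ≤ p.d := natDegree_shiftSum_le _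
  have hcase : ∀ {k : ℕ} (x : Fin k → ℝ) {Q : Prop}, (1 ≤ k → Q) →
      IsUnit (Polynomial.reflect k (1 + shiftSum x)) ∨ Q := by
    intro k x Q h
    rcases Nat.eq_zero_or_pos k with h0 | h0
    · exact Or.inl (isUnit_reflect_of_order_zero h0 x)
    · exact Or.inr (h h0)
  -- Multiplication by `z ^ (a + c + d)` and `z ^ (a + b + f)` turns the equations in `z⁻¹` into
  -- equations between the reflected polynomials of the coprimeness conditions. The exponent sums
  -- are reordered below to follow the order of the factors in each product.
  have he' := congrArg (Polynomial.reflect (p.a + p.c + p.d)) he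
  have hs' := congrArg (Polynomial.reflect (p.a + p.b + p.f)) hs
  simp only [sub_eq_add_neg, ← neg_mul, Polynomial.reflect_add] at he' hs'
  rw [reflect_mul_mul vA dC dD, show p.a + p.c + p.d = p.c + p.a + p.d by ring,
    reflect_mul_mul (by rwa [Polynomial.natDegree_neg]) dA dD,
    show p.c + p.a + p.d = p.d + p.a + p.c by ring, reflect_mul_mul vD dA dC,
    Polynomial.reflect_neg, Polynomial.reflect_zero] at he'
  rw [reflect_mul_mul vA dB dF, show p.a + p.b + p.f = p.b + p.a + p.f by ring,
    reflect_mul_mul (by rwa [Polynomial.natDegree_neg]) dA dF,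
    show p.b + p.a + p.f = p.f + p.a + p.b by ring, reflect_mul_mul vF dA dB,
    Polynomial.reflect_neg, Polynomial.reflect_zero] at hs'
  simp only [neg_mul, ← sub_eq_add_neg] at he' hs'
  obtain ⟨zA, zB, zC, zD, zF⟩ := tangent_eq_zero h1 h2 h3 (hcase _ h4) (hcase _ h5) (hcase _ h6)
    (degree_reflect_shiftSum_lt _ _) (degree_reflect_shiftSum_lt _ _)
    (degree_reflect_shiftSum_lt _ _) he' hs'
  rw [Polynomial.reflect_eq_zero_iff] at zA zB zC zD zF
  funext i
  rcases i with j | j | j | j | j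
  · exact shiftSum_eq_zero zA j
  · exact shiftSum_eq_zero zB j
  · exact shiftSum_eq_zero zF j
  · exact shiftSum_eq_zero zC j
  · exact shiftSum_eq_zero zD j

/-- At an identifiable parameter with a non-zero input filter, no direction is invisible in the
gradient of the prediction error. -/
theorem eq_zero_of_gradS_gradE_eq_zero {θ v : Param p} (hid : Identifiable θ)
    {g : PowerSeries ℝ} (hg : g ≠ 0) (hs : gradS θ g θ v = 0) (he : gradE θ θ v = 0) : v = 0 := by
  have hA : filt (polyA θ) * (filt (polyA θ))⁻¹ = 1 := filt_one_add_mul_inv _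
  have hF : filt (polyF θ) * (filt (polyF θ))⁻¹ = 1 := filt_one_add_mul_inv _
  have hC : filt (polyC θ) * (filt (polyC θ))⁻¹ = 1 := filt_one_add_mul_inv _
  have hD : filt (polyD θ) * (filt (polyD θ))⁻¹ = 1 := filt_one_add_mul_inv _
  have hs1 : gradY θ v * ((filt (polyA θ))⁻¹ * filt (polyB θ) * (filt (polyF θ))⁻¹) +
      gradU θ v = 0 := (mul_eq_zero.1 hs).resolve_right hg
  have he1 : gradY θ v * ((filt (polyA θ))⁻¹ * filt (polyC θ) * (filt (polyD θ))⁻¹) = 0 := he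
  rw [gradY, varA_apply, varC_apply, varD_apply] at he1
  rw [gradY, gradU, varA_apply, varB_apply, varC_apply, varD_apply, varF_apply] at hs1
  -- From here the inverses are opaque elements known only through `A * a = 1` and its analogues, so
  -- the rest is commutative algebra.
  generalize (filt (polyA θ))⁻¹ = a at *
  generalize (filt (polyF θ))⁻¹ = f at *
  generalize (filt (polyC θ))⁻¹ = c at *
  generalize (filt (polyD θ))⁻¹ = d at *
  have hD0 : filt (polyD θ) ≠ 0 := left_ne_zero_of_mul_eq_one hD
  have he2 : filt (shiftSum (parA v)) * filt (polyC θ) * filt (polyD θ) -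
      filt (shiftSum (parC v)) * filt (polyA θ) * filt (polyD θ) +
      filt (shiftSum (parD v)) * filt (polyA θ) * filt (polyC θ) = 0 := by
    have h := congrArg (· * (filt (polyA θ) * filt (polyC θ) * filt (polyD θ))) he1
    simp only [zero_mul] at h
    rw [← h]
    generalize filt (polyA θ) = A at *
    generalize filt (polyC θ) = C at *
    generalize filt (polyD θ) = D at *
    generalize filt (shiftSum (parA v)) = α
    generalize filt (shiftSum (parC v)) = γ
    generalize filt (shiftSum (parD v)) = δ
    calc _ = α * C * D * ((A * a) * (C * c) * (D * d)) -
          γ * A * D * ((A * a) * (C * c) * (C * c) * (D * d)) +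
          δ * A * C * ((A * a) * (C * c) * (D * d)) := by rw [hA, hC, hD]; ring
      _ = _ := by ring
  have hs2 : filt (shiftSum (parA v)) * filt (polyB θ) * filt (polyF θ) -
      filt (shiftSum (parB v)) * filt (polyA θ) * filt (polyF θ) +
      filt (shiftSum (parF v)) * filt (polyA θ) * filt (polyB θ) = 0 := by
    -- Clearing denominators yields the tangent equation times `D`, which is cancelled.
    refine (mul_eq_zero.1 ?_).resolve_left hD0
    have h := congrArg (· * (filt (polyA θ) * filt (polyF θ) * filt (polyC θ) * filt (polyF θ))) hs1
    simp only [zero_mul] at h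
    rw [← h]
    generalize filt (polyA θ) = A at *
    generalize filt (polyB θ) = B at *
    generalize filt (polyC θ) = C at *
    generalize filt (polyD θ) = D at *
    generalize filt (polyF θ) = F at *
    generalize filt (shiftSum (parA v)) = α at *
    generalize filt (shiftSum (parB v)) = β at *
    generalize filt (shiftSum (parC v)) = γ at *
    generalize filt (shiftSum (parD v)) = δ at *
    generalize filt (shiftSum (parF v)) = φ at *
    -- The `γ` and `δ` terms cancel: at the true parameter the response of the prediction error to
    -- the input is zero, so varying `C` and `D` does not affect this channel.
    calc _ = δ * B * A * F * ((A * a) * (C * c) * (F * f)) +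
          D * α * B * F * ((A * a) * (C * c) * (F * f)) -
          D * γ * B * A * F * c * ((A * a) * (C * c) * (F * f)) +
          D * B * γ * A * F * c * ((C * c) * (F * f)) +
          D * B * φ * A * ((F * f) * (F * f) * (C * c)) -
          (δ * B + D * β) * A * F * ((C * c) * (F * f)) := by rw [hA, hC, hF]; ring
      _ = _ := by ring
  refine eq_zero_of_tangent hid (Polynomial.coe_injective ℝ ?_) (Polynomial.coe_injective ℝ ?_)
  · simpa [filt] using he2
  · simpa [filt] using hs2

end LTI

end

noncomputable section

namespace LTI

/-! ### Second moments of filtered noise -/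

variable {Ω : Type*} [MeasurableSpace Ω] {P : Measure Ω}

theorem linearForm_mul {κ : Type*} (t : Finset κ) (a b x : κ → ℝ) :
    (∑ i ∈ t, a i * x i) * ∑ j ∈ t, b j * x j =
      ∑ i ∈ t, ∑ j ∈ t, a i * b j * (x i * x j) := by
  rw [Finset.sum_mul_sum]
  exact Finset.sum_congr rfl fun i _ => Finset.sum_congr rfl fun j _ => by ring

theorem integrable_linearForm_mul {κ : Type*} {ξ : κ → Ω → ℝ}
    (hint : ∀ i j, Integrable (fun ω => ξ i ω * ξ j ω) P) (t : Finset κ) (a b : κ → ℝ) :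
    Integrable (fun ω => (∑ i ∈ t, a i * ξ i ω) * ∑ j ∈ t, b j * ξ j ω) P := by
  simp only [fun ω => linearForm_mul t a b fun i => ξ i ω]
  exact integrable_finsetSum _ fun i _ => integrable_finsetSum _ fun j _ => (hint i j).const_mul _

theorem integral_linearForm_mul {κ : Type*} {ξ : κ → Ω → ℝ} {v : κ → ℝ}
    (hint : ∀ i j, Integrable (fun ω => ξ i ω * ξ j ω) P)
    (horth : ∀ i j, i ≠ j → ∫ ω, ξ i ω * ξ j ω ∂P = 0)
    (hvar : ∀ i, ∫ ω, ξ i ω * ξ i ω ∂P = v i) (t : Finset κ) (a b : κ → ℝ) :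
    ∫ ω, (∑ i ∈ t, a i * ξ i ω) * ∑ j ∈ t, b j * ξ j ω ∂P = ∑ i ∈ t, a i * b i * v i := by
  simp only [fun ω => linearForm_mul t a b fun i => ξ i ω]
  rw [integral_finsetSum _ fun i _ => integrable_finsetSum _ fun j _ => (hint i j).const_mul _]
  refine Finset.sum_congr rfl fun i hi => ?_
  rw [integral_finsetSum _ fun j _ => (hint i j).const_mul _, Finset.sum_eq_single i]
  · rw [integral_const_mul, hvar]
  · intro j _ hj
    rw [integral_const_mul, horth i j hj.symm, mul_zero]
  · exact fun h => absurd hi h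

/-- The integral of a non-integrable function is `0` by convention, so a positive second moment
already forces square integrability. -/
theorem IsNoise.memLp_two {x : ℕ → Ω → ℝ} {v : ℝ} (hx : IsNoise P x v) (hv : 0 < v) (n : ℕ) :
    MemLp (x n) 2 P := by
  rw [memLp_two_iff_integrable_sq (hx.1 n).aestronglyMeasurable]
  by_contra h
  have := hx.2.2.2.1 n
  rw [integral_undef h] at this
  exact hv.ne this

section TwoNoises

variable {e s : ℕ → Ω → ℝ} {ve vs : ℝ}

theorem integrable_noise_mul (he : IsNoise P e ve) (hs : IsNoise P s vs) (hve : 0 < ve)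
    (hvs : 0 < vs) (i j : ℕ ⊕ ℕ) :
    Integrable (fun ω => Sum.elim s e i ω * Sum.elim s e j ω) P := by
  have h : ∀ i : ℕ ⊕ ℕ, MemLp (Sum.elim s e i) 2 P := by
    rintro (i | i)
    · exact hs.memLp_two hvs i
    · exact he.memLp_two hve i
  exact (h i).integrable_mul (h j)

/-- Indexing both sequences by `ℕ ⊕ ℕ`, with `s` on the left and `e` on the right, makes them one
orthogonal family. Pairs within a sequence and pairs across the two are each independent and
centred. -/
theorem integral_noise_mul_of_ne (he : IsNoise P e ve) (hs : IsNoise P s vs)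
    (hes : IndepFun (fun ω n => e n ω) (fun ω n => s n ω) P) (i j : ℕ ⊕ ℕ) (hij : i ≠ j) :
    ∫ ω, Sum.elim s e i ω * Sum.elim s e j ω ∂P = 0 := by
  have hmeas : ∀ i : ℕ ⊕ ℕ, Measurable (Sum.elim s e i) := by
    rintro (i | i)
    · exact hs.1 i
    · exact he.1 i
  have hmean : ∀ i : ℕ ⊕ ℕ, ∫ ω, Sum.elim s e i ω ∂P = 0 := by
    rintro (i | i)
    · exact hs.2.2.1 i
    · exact he.2.2.1 i
  have hcross : ∀ i j : ℕ, IndepFun (e i) (s j) P := fun i j =>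
    hes.comp (measurable_pi_apply i) (measurable_pi_apply j)
  have hind : IndepFun (Sum.elim s e i) (Sum.elim s e j) P := by
    rcases i with i | i <;> rcases j with j | j
    · exact hs.2.1.indepFun fun h => hij (congrArg _ h)
    · exact (hcross j i).symm
    · exact hcross i j
    · exact he.2.1.indepFun fun h => hij (congrArg _ h)
  have := hind.integral_mul_eq_mul_integral (hmeas i).aestronglyMeasurable
    (hmeas j).aestronglyMeasurable
  rw [hmean, zero_mul] at this
  exact this

theorem integral_noise_mul_self (he : IsNoise P e ve) (hs : IsNoise P s vs) (i : ℕ ⊕ ℕ) :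
    ∫ ω, Sum.elim s e i ω * Sum.elim s e i ω ∂P = Sum.elim (fun _ => vs) (fun _ => ve) i := by
  rcases i with i | i
  · simpa [sq] using hs.2.2.2.1 i
  · simpa [sq] using he.2.2.2.1 i

theorem coeff_filtered_noise {Ω : Type*} {e s : ℕ → Ω → ℝ} (a b : PowerSeries ℝ) (n : ℕ) (ω : Ω) :
    PowerSeries.coeff n (a * PowerSeries.mk (fun k => s k ω) + b * PowerSeries.mk fun k => e k ω) =
      ∑ i ∈ (Finset.range (n + 1)).disjSum (Finset.range (n + 1)),
        Sum.elim (fun k => PowerSeries.coeff (n - k) a) (fun k => PowerSeries.coeff (n - k) b) i *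
          Sum.elim s e i ω := by
  have h : ∀ (c : PowerSeries ℝ) (x : ℕ → ℝ), PowerSeries.coeff n (c * PowerSeries.mk x) =
      ∑ k ∈ Finset.range (n + 1), PowerSeries.coeff (n - k) c * x k := by
    intro c x
    rw [mul_comm, PowerSeries.coeff_mul, Finset.Nat.sum_antidiagonal_eq_sum_range_succ
      (fun i j => PowerSeries.coeff i (PowerSeries.mk x) * PowerSeries.coeff j c)]
    refine Finset.sum_congr rfl fun k _ => ?_
    rw [PowerSeries.coeff_mk, mul_comm]
  rw [map_add, h, h, Finset.sum_disjSum]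
  rfl

theorem integrable_filtered_noise_mul (he : IsNoise P e ve) (hs : IsNoise P s vs) (hve : 0 < ve)
    (hvs : 0 < vs) (a b a' b' : PowerSeries ℝ) (n : ℕ) :
    Integrable (fun ω =>
      PowerSeries.coeff n
        (a * PowerSeries.mk (fun k => s k ω) + b * PowerSeries.mk fun k => e k ω) *
      PowerSeries.coeff n
        (a' * PowerSeries.mk (fun k => s k ω) + b' * PowerSeries.mk fun k => e k ω)) P := by
  simp only [coeff_filtered_noise]
  exact integrable_linearForm_mul (integrable_noise_mul he hs hve hvs) _ _ _

/-- Reversing time turns the sum over noise instants into a sum over lags. As the signals start at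
rest, the moment at time `n` is exactly a partial sum, with `n + 1` terms, of a series not depending
on `n`. -/
theorem integral_filtered_noise_mul (he : IsNoise P e ve) (hs : IsNoise P s vs) (hve : 0 < ve)
    (hvs : 0 < vs) (hes : IndepFun (fun ω n => e n ω) (fun ω n => s n ω) P)
    (a b a' b' : PowerSeries ℝ) (n : ℕ) :
    ∫ ω, PowerSeries.coeff n
        (a * PowerSeries.mk (fun k => s k ω) + b * PowerSeries.mk fun k => e k ω) *
      PowerSeries.coeff n
        (a' * PowerSeries.mk (fun k => s k ω) + b' * PowerSeries.mk fun k => e k ω) ∂P =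
      ∑ k ∈ Finset.range (n + 1), (vs * (PowerSeries.coeff k a * PowerSeries.coeff k a') +
        ve * (PowerSeries.coeff k b * PowerSeries.coeff k b')) := by
  simp only [coeff_filtered_noise]
  rw [integral_linearForm_mul (integrable_noise_mul he hs hve hvs)
    (integral_noise_mul_of_ne he hs hes) (integral_noise_mul_self he hs), Finset.sum_disjSum,
    ← Finset.sum_add_distrib, ← Finset.sum_range_reflect]
  refine Finset.sum_congr rfl fun k hk => ?_
  have h : n - (n + 1 - 1 - k) = k := by
    have := Finset.mem_range.1 hk
    omega
  simp only [Sum.elim_inl, Sum.elim_inr, h]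
  ring

end TwoNoises

/-! ### Gram matrices of impulse responses -/

section Gram

variable {ι : Type*}

/-- The summand at lag `k` of the weighted Gram matrix of two families of impulse responses. -/
def gramTerm (vs ve : ℝ) (a b : ι → PowerSeries ℝ) (k : ℕ) (i j : ι) : ℝ :=
  vs * (PowerSeries.coeff k (a i) * PowerSeries.coeff k (a j)) +
    ve * (PowerSeries.coeff k (b i) * PowerSeries.coeff k (b j))

def partialGram (vs ve : ℝ) (a b : ι → PowerSeries ℝ) (n : ℕ) : Matrix ι ι ℝ :=
  Matrix.of fun i j => ∑ k ∈ Finset.range n, gramTerm vs ve a b k i j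

def gram (vs ve : ℝ) (a b : ι → PowerSeries ℝ) : Matrix ι ι ℝ :=
  Matrix.of fun i j => ∑' k, gramTerm vs ve a b k i j

variable {vs ve : ℝ} {a b : ι → PowerSeries ℝ}

/-- This is the diagonal of an absolutely summable double series. -/
theorem AbsSummable.summable_coeff_mul_coeff {f g : PowerSeries ℝ} (hf : AbsSummable f)
    (hg : AbsSummable g) : Summable fun k => PowerSeries.coeff k f * PowerSeries.coeff k g := by
  refine Summable.of_norm ?_
  simp only [norm_mul]
  simpa only [Function.comp_def, norm_norm, norm_mul] using
    (summable_mul_of_summable_norm hf.norm hg.norm).comp_injective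
      (i := fun k : ℕ => (k, k)) fun _ _ h => congrArg Prod.fst h

theorem tendsto_partialGram (ha : ∀ i, AbsSummable (a i)) (hb : ∀ i, AbsSummable (b i)) :
    Tendsto (partialGram vs ve a b) atTop (𝓝 (gram vs ve a b)) := by
  refine tendsto_pi_nhds.2 fun i => tendsto_pi_nhds.2 fun j => ?_
  exact ((((ha i).summable_coeff_mul_coeff (ha j)).mul_left vs).add
    (((hb i).summable_coeff_mul_coeff (hb j)).mul_left ve)).hasSum.tendsto_sum_nat

variable [Fintype ι]

/-- Each lag contributes a weighted sum of two squares. For nonnegative weights the quadratic form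
is thus monotone in `n`, and for positive weights its vanishing kills every lag separately. -/
theorem dotProduct_partialGram_mulVec (v : ι → ℝ) (n : ℕ) :
    v ⬝ᵥ (partialGram vs ve a b n).mulVec v = ∑ k ∈ Finset.range n,
      (vs * (∑ i, v i * PowerSeries.coeff k (a i)) ^ 2 +
        ve * (∑ i, v i * PowerSeries.coeff k (b i)) ^ 2) := by
  simp only [dotProduct, Matrix.mulVec, partialGram, gramTerm, Matrix.of_apply, Finset.mul_sum,
    Finset.sum_mul]
  calc _ = ∑ k ∈ Finset.range n, ∑ i, ∑ j, v i * ((vs * (PowerSeries.coeff k (a i) *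
        PowerSeries.coeff k (a j)) + ve * (PowerSeries.coeff k (b i) *
        PowerSeries.coeff k (b j))) * v j) := by
        symm
        rw [Finset.sum_comm]
        refine Finset.sum_congr rfl fun i _ => ?_
        rw [Finset.sum_comm]
    _ = _ := by
        refine Finset.sum_congr rfl fun k _ => ?_
        rw [sq, sq, Finset.sum_mul_sum, Finset.sum_mul_sum, Finset.mul_sum, Finset.mul_sum,
          ← Finset.sum_add_distrib]
        refine Finset.sum_congr rfl fun i _ => ?_
        rw [Finset.mul_sum, Finset.mul_sum, ← Finset.sum_add_distrib]
        refine Finset.sum_congr rfl fun j _ => ?_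
        ring

theorem dotProduct_partialGram_le_gram (hvs : 0 ≤ vs) (hve : 0 ≤ ve)
    (ha : ∀ i, AbsSummable (a i)) (hb : ∀ i, AbsSummable (b i)) (v : ι → ℝ) (n : ℕ) :
    v ⬝ᵥ (partialGram vs ve a b n).mulVec v ≤ v ⬝ᵥ (gram vs ve a b).mulVec v := by
  have hcont : Continuous fun M : Matrix ι ι ℝ => v ⬝ᵥ M.mulVec v := by fun_prop
  refine ge_of_tendsto ((hcont.tendsto _).comp (tendsto_partialGram ha hb)) ?_
  filter_upwards [eventually_ge_atTop n] with N hN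
  simp only [Function.comp_apply, dotProduct_partialGram_mulVec]
  exact Finset.sum_le_sum_of_subset_of_nonneg (Finset.range_mono hN) fun k _ _ => by positivity

theorem sum_coeff_eq_zero_of_partialGram (hvs : 0 < vs) (hve : 0 < ve) {v : ι → ℝ} {n : ℕ}
    (h : v ⬝ᵥ (partialGram vs ve a b n).mulVec v ≤ 0) {k : ℕ} (hk : k < n) :
    ∑ i, v i * PowerSeries.coeff k (a i) = 0 ∧ ∑ i, v i * PowerSeries.coeff k (b i) = 0 := by
  rw [dotProduct_partialGram_mulVec] at h
  have hnn : ∀ k ∈ Finset.range n, 0 ≤ vs * (∑ i, v i * PowerSeries.coeff k (a i)) ^ 2 +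
      ve * (∑ i, v i * PowerSeries.coeff k (b i)) ^ 2 := fun k _ => by positivity
  have h0 := (Finset.sum_eq_zero_iff_of_nonneg hnn).1 (le_antisymm h (Finset.sum_nonneg hnn)) k
    (Finset.mem_range.2 hk)
  rw [add_eq_zero_iff_of_nonneg (by positivity) (by positivity)] at h0
  simpa [hvs.ne', hve.ne'] using h0

variable [DecidableEq ι]

/-- If the limit form is not positive at `v`, neither is the smaller partial form, so its squares
vanish and `v` lies in the kernel of the partial matrix. Positivity of an infinite sum is thereby
read off from a finite determinant. -/
theorem posDef_gram_of_det_partialGram_ne_zero (hvs : 0 < vs) (hve : 0 < ve)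
    (ha : ∀ i, AbsSummable (a i)) (hb : ∀ i, AbsSummable (b i)) {n : ℕ}
    (hdet : (partialGram vs ve a b n).det ≠ 0) : (gram vs ve a b).PosDef := by
  refine Matrix.PosDef.of_dotProduct_mulVec_pos ?_ fun v hv => ?_
  · ext i j
    simp only [Matrix.conjTranspose_apply, star_trivial, gram, Matrix.of_apply, gramTerm]
    exact tsum_congr fun k => by ring
  · rw [star_trivial]
    by_contra hle
    have h0 := (dotProduct_partialGram_le_gram hvs.le hve.le ha hb v n).trans (not_lt.1 hle)
    refine hv (Matrix.eq_zero_of_mulVec_eq_zero hdet ?_)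
    ext i
    simp only [Matrix.mulVec, dotProduct, partialGram, gramTerm, Matrix.of_apply, Finset.sum_mul,
      Pi.zero_apply]
    rw [Finset.sum_comm]
    refine Finset.sum_eq_zero fun k hk => ?_
    obtain ⟨h1, h2⟩ := sum_coeff_eq_zero_of_partialGram hvs hve h0 (Finset.mem_range.1 hk)
    calc _ = vs * PowerSeries.coeff k (a i) * ∑ j, v j * PowerSeries.coeff k (a j) +
          ve * PowerSeries.coeff k (b i) * ∑ j, v j * PowerSeries.coeff k (b j) := by
          rw [Finset.mul_sum, Finset.mul_sum, ← Finset.sum_add_distrib]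
          exact Finset.sum_congr rfl fun j _ => by ring
      _ = 0 := by rw [h1, h2, mul_zero, mul_zero, add_zero]

/-- A kernel vector of the full Gram matrix would annihilate both families at every lag. Hence its
determinant is nonzero, and the determinants of the partial matrices converge to it. -/
theorem exists_det_partialGram_ne_zero (hvs : 0 < vs) (hve : 0 < ve)
    (ha : ∀ i, AbsSummable (a i)) (hb : ∀ i, AbsSummable (b i))
    (hli : ∀ v : ι → ℝ, ∑ i, v i • a i = 0 → ∑ i, v i • b i = 0 → v = 0) :
    ∃ n, (partialGram vs ve a b n).det ≠ 0 := by
  have hdet : (gram vs ve a b).det ≠ 0 := by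
    intro h
    obtain ⟨v, hv, hv0⟩ := Matrix.exists_mulVec_eq_zero_iff.2 h
    have hle : ∀ n, v ⬝ᵥ (partialGram vs ve a b n).mulVec v ≤ 0 := fun n =>
      (dotProduct_partialGram_le_gram hvs.le hve.le ha hb v n).trans (by rw [hv0, dotProduct_zero])
    refine hv (hli v ?_ ?_)
    · ext k
      simpa using (sum_coeff_eq_zero_of_partialGram hvs hve (hle (k + 1)) k.lt_succ_self).1
    · ext k
      simpa using (sum_coeff_eq_zero_of_partialGram hvs hve (hle (k + 1)) k.lt_succ_self).2
  have hcont : Continuous fun M : Matrix ι ι ℝ => M.det := continuous_id.matrix_det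
  exact (((hcont.tendsto _).comp (tendsto_partialGram ha hb)).eventually_ne hdet).exists

theorem continuousAt_det_partialGram {E : Type*} [TopologicalSpace E] {x : E}
    {a b : E → ι → PowerSeries ℝ} (ha : ∀ i, SeriesContAt (fun y => a y i) x)
    (hb : ∀ i, SeriesContAt (fun y => b y i) x) (n : ℕ) :
    ContinuousAt (fun y => (partialGram vs ve (a y) (b y) n).det) x := by
  have hcont : Continuous fun M : Matrix ι ι ℝ => M.det := continuous_id.matrix_det
  refine hcont.continuousAt.comp (f := fun y => partialGram vs ve (a y) (b y) n) ?_
  refine tendsto_pi_nhds.2 fun i => tendsto_pi_nhds.2 fun j => ?_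
  refine tendsto_finsetSum (Finset.range n) fun k _ => ?_
  exact ((((ha i) k).mul ((ha j) k)).const_mul vs).add ((((hb i) k).mul ((hb j) k)).const_mul ve)

end Gram

end LTI

end

namespace LTI

/-! ### Stability, continuity and non-degeneracy of the gradient filters -/

variable {p : Orders} {R Ω : Type*} {m : ℕ}

theorem absSummable_inv_filt_one_add {k : ℕ} {x : Fin k → ℝ} (h : NoZeroOutside (1 + shiftSum x)) :
    AbsSummable (filt (1 + shiftSum x))⁻¹ :=
  absSummable_inv_coe (by simp [coeff_zero_shiftSum]) h

theorem absSummable_gradY {θ : Param p} (hC : NoZeroOutside (polyC θ)) (v : Param p) :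
    AbsSummable (gradY θ v) := by
  have c : ∀ Q : Polynomial ℝ, AbsSummable (filt Q) := AbsSummable.coe
  have iC : AbsSummable (filt (polyC θ))⁻¹ := absSummable_inv_filt_one_add hC
  rw [gradY, varA_apply, varC_apply, varD_apply]
  exact ((((c _).mul (c _)).add ((c _).mul (c _))).mul iC).sub
    (((c _).mul (c _)).mul ((c _).mul (iC.mul iC)))

theorem absSummable_gradU {θ : Param p} (hC : NoZeroOutside (polyC θ))
    (hF : NoZeroOutside (polyF θ)) (v : Param p) : AbsSummable (gradU θ v) := by
  have c : ∀ Q : Polynomial ℝ, AbsSummable (filt Q) := AbsSummable.coe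
  have iC : AbsSummable (filt (polyC θ))⁻¹ := absSummable_inv_filt_one_add hC
  have iF : AbsSummable (filt (polyF θ))⁻¹ := absSummable_inv_filt_one_add hF
  rw [gradU, varB_apply, varC_apply, varD_apply, varF_apply]
  exact (((c _).mul (c _)).mul ((((c _).mul (iC.mul iC)).mul iF).add
    (((c _).mul (iF.mul iF)).mul iC))).sub ((((c _).mul (c _)).add ((c _).mul (c _))).mul (iC.mul iF))

theorem absSummable_gradS {θs θ : Param p} (hst : StableParam θs) (hC : NoZeroOutside (polyC θ))
    (hF : NoZeroOutside (polyF θ)) {g : PowerSeries ℝ} (hg : AbsSummable g) (v : Param p) :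
    AbsSummable (gradS θs g θ v) :=
  (((absSummable_gradY hC v).mul (((absSummable_inv_filt_one_add hst.1).mul
    (AbsSummable.coe _)).mul (absSummable_inv_filt_one_add hst.2.1))).add
      (absSummable_gradU hC hF v)).mul hg

theorem absSummable_gradE {θs θ : Param p} (hst : StableParam θs) (hC : NoZeroOutside (polyC θ))
    (v : Param p) : AbsSummable (gradE θs θ v) :=
  (absSummable_gradY hC v).mul (((absSummable_inv_filt_one_add hst.1).mul
    (AbsSummable.coe _)).mul (absSummable_inv_filt_one_add hst.2.2.2))

theorem seriesContAt_gradY (θ v : Param p) : SeriesContAt (fun θ => gradY θ v) θ := by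
  have hA := (hasSeriesDerivAt_filt_polyA θ).seriesContAt
  have hC := (hasSeriesDerivAt_filt_polyC_inv θ).seriesContAt
  have hD := (hasSeriesDerivAt_filt_polyD θ).seriesContAt
  have c := fun φ => SeriesContAt.const φ θ
  exact ((((c _).mul hA).add (hD.mul (c _))).mul hC).sub
    ((hD.mul hA).mul ((c _).mul (hC.mul hC)))

theorem seriesContAt_gradU (θ v : Param p) : SeriesContAt (fun θ => gradU θ v) θ := by
  have hB := (hasSeriesDerivAt_filt_polyB θ).seriesContAt
  have hC := (hasSeriesDerivAt_filt_polyC_inv θ).seriesContAt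
  have hD := (hasSeriesDerivAt_filt_polyD θ).seriesContAt
  have hF := (hasSeriesDerivAt_filt_polyF_inv θ).seriesContAt
  have c := fun φ => SeriesContAt.const φ θ
  exact ((hD.mul hB).mul ((((c _).mul (hC.mul hC)).mul hF).add
    (((c _).mul (hF.mul hF)).mul hC))).sub ((((c _).mul hB).add (hD.mul (c _))).mul (hC.mul hF))

theorem seriesContAt_gradS (θs : Param p) {g : Param p → PowerSeries ℝ} {θ : Param p}
    (hg : SeriesContAt g θ) (v : Param p) : SeriesContAt (fun θ => gradS θs (g θ) θ v) θ :=
  (((seriesContAt_gradY θ v).mul (.const _ θ)).add (seriesContAt_gradU θ v)).mul hg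

theorem seriesContAt_gradE (θs θ v : Param p) : SeriesContAt (fun θ => gradE θs θ v) θ :=
  (seriesContAt_gradY θ v).mul (.const _ θ)

theorem seriesContAt_genImpulse [TopologicalSpace R] (gen : InputGenerator R m) {E : Type*}
    [TopologicalSpace E] {r : E → R} {D : Set E} {x : E} (hx : D ∈ 𝓝 x) (hr : ContinuousOn r D)
    (hAz : ContinuousOn gen.Az (r '' D)) (hBz : ContinuousOn gen.Bz (r '' D))
    (hCz : ContinuousOn gen.Cz (r '' D)) (hDz : ContinuousOn gen.Dz (r '' D)) :
    SeriesContAt (fun y => genImpulse gen (r y)) x := by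
  have hA : ContinuousAt (fun y => gen.Az (r y)) x :=
    (hAz.comp hr (Set.mapsTo_image r D)).continuousAt hx
  have hB : ContinuousAt (fun y => gen.Bz (r y)) x :=
    (hBz.comp hr (Set.mapsTo_image r D)).continuousAt hx
  have hC : ContinuousAt (fun y => gen.Cz (r y)) x :=
    (hCz.comp hr (Set.mapsTo_image r D)).continuousAt hx
  have hD : ContinuousAt (fun y => gen.Dz (r y)) x :=
    (hDz.comp hr (Set.mapsTo_image r D)).continuousAt hx
  intro n
  simp only [genImpulse, PowerSeries.coeff_mk]
  split_ifs
  · exact hD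
  · have hcont : Continuous fun q : (Fin m → ℝ) × Matrix (Fin m) (Fin m) ℝ × (Fin m → ℝ) =>
        q.1 ⬝ᵥ (q.2.1 ^ (n - 1)).mulVec q.2.2 := by fun_prop
    exact hcont.continuousAt.comp (hC.prodMk (hA.prodMk hB))

/-- The impulse responses from `s` to the coordinates of the gradient. -/
noncomputable abbrev coordS (θs : Param p) (g : PowerSeries ℝ) (θ : Param p) :
    Idx p → PowerSeries ℝ :=
  fun i => gradS θs g θ (Pi.single i 1)

/-- The impulse responses from `e` to the coordinates of the gradient. -/
noncomputable abbrev coordE (θs θ : Param p) : Idx p → PowerSeries ℝ :=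
  fun i => gradE θs θ (Pi.single i 1)

theorem sum_smul_apply_single {ι M : Type*} [Fintype ι] [DecidableEq ι] [AddCommGroup M]
    [Module ℝ M] (l : (ι → ℝ) →ₗ[ℝ] M) (v : ι → ℝ) : ∑ i, v i • l (Pi.single i 1) = l v := by
  simp only [← map_smul, ← map_sum]
  congr 1
  ext i
  simp [Finset.sum_apply, Pi.single_apply]

theorem eq_zero_of_sum_coord_eq_zero {θ : Param p} (hid : Identifiable θ) {g : PowerSeries ℝ}
    (hg : g ≠ 0) (v : Idx p → ℝ) (hs : ∑ i, v i • coordS θ g θ i = 0)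
    (he : ∑ i, v i • coordE θ θ i = 0) : v = 0 := by
  rw [sum_smul_apply_single] at hs he
  exact eq_zero_of_gradS_gradE_eq_zero hid hg hs he

variable [MeasurableSpace Ω] {P : Measure Ω} {e s : ℕ → Ω → ℝ} {ve vs : ℝ}

theorem gradSecondMoment_eq_partialGram (he : IsNoise P e ve) (hs : IsNoise P s vs) (hve : 0 < ve)
    (hvs : 0 < vs) (hes : IndepFun (fun ω n => e n ω) (fun ω n => s n ω) P) (θs : Param p)
    (gen : InputGenerator R m) (r : R) (θ : Param p) (n : ℕ) :
    gradSecondMoment P θs gen r e s θ n =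
      partialGram vs ve (coordS θs (genImpulse gen r) θ) (coordE θs θ) (n + 1) := by
  ext i j
  simp only [gradSecondMoment, Matrix.of_apply, errGradProc_eq_coeff]
  rw [integral_filtered_noise_mul he hs hve hvs hes]
  rfl

end LTI

/-! ### The main theorem -/

theorem lemma1 {Ω : Type*} [MeasurableSpace Ω] (P : Measure Ω) [IsProbabilityMeasure P]
    {R : Type*} [TopologicalSpace R] {m : ℕ} {p : LTI.Orders}
    -- the parameter domain
    (g : LTI.Param p → ℝ) (hg : Continuous g) (hg0 : ∀ θ, 0 ≤ g θ) (K : ℝ) (hK : 0 < K)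
    (DC : Set (Fin p.c → ℝ)) (hDC : IsCompact DC) (hDCconv : Convex ℝ DC)
    (hDClyap : LTI.HasCommonLyapunov DC)
    (DF : Set (Fin p.f → ℝ)) (hDF : IsCompact DF) (hDFconv : Convex ℝ DF)
    (hDFlyap : LTI.HasCommonLyapunov DF)
    (hcompact : IsCompact (LTI.paramDomain g K DC DF))
    -- the true system
    (θs : LTI.Param p) (hθs : θs ∈ interior (LTI.paramDomain g K DC DF))
    (hstable : LTI.StableParam θs) (hident : LTI.Identifiable θs)
    -- the noise and the external source
    (e s : ℕ → Ω → ℝ) (σ : ℝ) (hσ : 0 < σ)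
    (he : LTI.IsNoise P e (σ ^ 2)) (hs : LTI.IsNoise P s 1)
    (hes : IndepFun (fun ω n => e n ω) (fun ω n => s n ω) P)
    -- the input generator
    (r : LTI.Param p → R) (hr : ContinuousOn r (LTI.paramDomain g K DC DF))
    (gen : LTI.InputGenerator R m)
    (hAz : ContinuousOn gen.Az (r '' LTI.paramDomain g K DC DF))
    (hBz : ContinuousOn gen.Bz (r '' LTI.paramDomain g K DC DF))
    (hCz : ContinuousOn gen.Cz (r '' LTI.paramDomain g K DC DF))
    (hDz : ContinuousOn gen.Dz (r '' LTI.paramDomain g K DC DF))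
    (hjsr : LTI.jointSpectralRadius
      ((fun θ => gen.Az (r θ)) '' LTI.paramDomain g K DC DF) < 1)
    -- persistence of excitation at the true parameter
    (hpe : ∀ᵐ w : ℝ, 0 < LTI.inputSpectrum gen (r θs) w) :
    -- the gradient, its second moments and their limit are well defined on the domain
    (∀ θ ∈ LTI.paramDomain g K DC DF, ∀ n,
      (∀ ω, DifferentiableAt ℝ (fun θ' => LTI.errProc θs gen (r θ) e s θ' n ω) θ) ∧
      ∀ i j, Integrable (fun ω => LTI.errGradProc θs gen (r θ) e s θ n ω i *
        LTI.errGradProc θs gen (r θ) e s θ n ω j) P) ∧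
    ∃ G : LTI.Param p → Matrix (LTI.Idx p) (LTI.Idx p) ℝ,
      (∀ θ ∈ LTI.paramDomain g K DC DF,
        Tendsto (fun n => LTI.gradSecondMoment P θs gen (r θ) e s θ n) atTop (𝓝 (G θ))) ∧
      ∃ D : Set (LTI.Param p), D ⊆ LTI.paramDomain g K DC DF ∧ θs ∈ interior D ∧
        ∀ θ ∈ D, (G θ).PosDef := by
  have hσ2 : 0 < σ ^ 2 := pow_pos hσ 2
  have hC : ∀ θ ∈ LTI.paramDomain g K DC DF, LTI.NoZeroOutside (LTI.polyC θ) := fun θ hθ =>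
    LTI.noZeroOutside_of_lyapunov hDClyap hθ.2.1
  have hF : ∀ θ ∈ LTI.paramDomain g K DC DF, LTI.NoZeroOutside (LTI.polyF θ) := fun θ hθ =>
    LTI.noZeroOutside_of_lyapunov hDFlyap hθ.2.2
  have hgen : ∀ θ ∈ LTI.paramDomain g K DC DF,
      LTI.AbsSummable (LTI.genImpulse gen (r θ)) := fun θ hθ =>
    LTI.absSummable_genImpulse gen (r θ) ((LTI.spectralRadius_le_jointSpectralRadius
      (Set.mem_image_of_mem (fun θ => gen.Az (r θ)) hθ)).trans_lt hjsr)
  have hS : ∀ θ ∈ LTI.paramDomain g K DC DF, ∀ i,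
      LTI.AbsSummable (LTI.coordS θs (LTI.genImpulse gen (r θ)) θ i) := fun θ hθ i =>
    LTI.absSummable_gradS hstable (hC θ hθ) (hF θ hθ) (hgen θ hθ) _
  have hE : ∀ θ ∈ LTI.paramDomain g K DC DF, ∀ i, LTI.AbsSummable (LTI.coordE θs θ i) :=
    fun θ hθ i => LTI.absSummable_gradE hstable (hC θ hθ) _
  have hmem : LTI.paramDomain g K DC DF ∈ 𝓝 θs := mem_interior_iff_mem_nhds.1 hθs
  -- One frequency with positive spectrum suffices to make the impulse response nonzero.
  obtain ⟨w, hw⟩ := hpe.exists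
  obtain ⟨N, hN⟩ := LTI.exists_det_partialGram_ne_zero one_pos hσ2 (hS θs (interior_subset hθs))
    (hE θs (interior_subset hθs))
    (LTI.eq_zero_of_sum_coord_eq_zero hident (LTI.genImpulse_ne_zero gen (r θs) w hw))
  have hcont := LTI.continuousAt_det_partialGram (vs := 1) (ve := σ ^ 2) (x := θs)
    (a := fun θ => LTI.coordS θs (LTI.genImpulse gen (r θ)) θ) (b := LTI.coordE θs)
    (fun i => LTI.seriesContAt_gradS θs
      (LTI.seriesContAt_genImpulse gen hmem hr hAz hBz hCz hDz) (Pi.single i 1))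
    (fun i => LTI.seriesContAt_gradE θs θs (Pi.single i 1)) N
  refine ⟨fun θ _ n => ⟨fun ω => LTI.differentiableAt_predError θ _ _ n, fun i j => ?_⟩,
    fun θ => LTI.gram 1 (σ ^ 2) (LTI.coordS θs (LTI.genImpulse gen (r θ)) θ) (LTI.coordE θs θ),
    fun θ hθ => ?_,
    -- The neighbourhood is the part of the domain where the partial Gram matrix with the fixed
    -- number `N` of lags, chosen at `θs`, remains nonsingular.
    {θ | θ ∈ LTI.paramDomain g K DC DF ∧ (LTI.partialGram 1 (σ ^ 2)
      (LTI.coordS θs (LTI.genImpulse gen (r θ)) θ) (LTI.coordE θs θ) N).det ≠ 0},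
    fun θ hθ => hθ.1, ?_, fun θ hθ => ?_⟩
  · simp only [LTI.errGradProc_eq_coeff]
    exact LTI.integrable_filtered_noise_mul he hs hσ2 one_pos _ _ _ _ n
  · simp only [LTI.gradSecondMoment_eq_partialGram he hs hσ2 one_pos hes]
    -- The moment at time `n` has `n + 1` lags, hence the shift of the index.
    exact (LTI.tendsto_partialGram (hS θ hθ) (hE θ hθ)).comp (tendsto_add_atTop_nat 1)
  · exact mem_interior_iff_mem_nhds.2 (inter_mem hmem (hcont.eventually_ne hN))
  · exact LTI.posDef_gram_of_det_partialGram_ne_zero one_pos hσ2 (hS θ hθ.1) (hE θ hθ.1) hθ.2
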